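/- Let $\mathbb K=\mathbb R$ or $\mathbb C$. A sequence class $X$ assigns to each Banach space $E$ over $\mathbb K$ a Banach space $X(E)$, which is a linear subspace of $E^{\mathbb N}$ containing all finitely supported sequences, with $\sup_j\|x_j\|\le\|(x_j)_{j}\|_{X(E)}$ on $X(E)$ and $\|e_j\|_{X(\mathbb K)}=1$ for every $j$. It is called multilinearly stable if for all $n\ge 1$, all Banach spaces $E_1,\dots,E_n,F$ over $\mathbb K$ and every continuous $n$-linear operator $A\colon E_1\times\cdots\times E_n\to F$, the map $$\widehat A\big((x^1_j)_j,\dots,(x^n_j)_j\big)=\big(A(x^1_j,\dots,x^n_j)\big)_j$$ sends $X(E_1)\times\cdots\times X(E_n)$ into $X(F)$ and, as an $n$-linear operator between these spaces, is continuous with $\|\widehat A\|=\|A\|$. Let $r_j(t)=\operatorname{sign}\sin(2^j\pi t)$, $j\ge1$, be the Rademacher functions. Let $\mathrm{Rad}(E)$ be the space of all sequences $(x_j)_{j=1}^\infty$ in $E$ such that $\sum_{j=1}^\infty r_j(t)x_j$ converges in $E$ for almost every $t\in[0,1]$, with the norm $$\|(x_j)_{j=1}^\infty\|_{\mathrm{Rad}(E)}=\Big(\int_0^1\Big\|\sum_{j=1}^\infty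 r_j(t)x_j\Big\|^2dt\Big)^{1/2},$$ and let $\mathrm{RAD}(E)$ be the space of all sequences $(x_j)_{j=1}^\infty$ in $E$ with $$\|(x_j)_{j=1}^\infty\|_{\mathrm{RAD}(E)}:=\sup_k\|(x_1,\dots,x_k,0,0,\dots)\|_{\mathrm{Rad}(E)}<\infty .$$ Theorem. $\mathrm{Rad}(\cdot)$ and $\mathrm{RAD}(\cdot)$ are sequence classes, and both are multilinearly stable. -/

import Mathlib

open MeasureTheory Filter Topology

universe u

/-- The Rademacher functions `r₁, r₂, …` on `[0,1]`, indexed from `0`: `rademacher j` is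
`r_{j+1}`, that is `t ↦ sign (sin (2^(j+1) π t))`. -/
noncomputable def rademacher (j : ℕ) (t : ℝ) : ℝ :=
  Real.sign (Real.sin (2 ^ (j + 1) * Real.pi * t))

section Rademacher

variable {E : Type*} [NormedAddCommGroup E] [NormedSpace ℝ E]

/-- The partial sums `∑_{j < N} r_j(t) x_j` of the Rademacher series of `x`. -/
noncomputable def radPartialSum (x : ℕ → E) (t : ℝ) (N : ℕ) : E :=
  ∑ j ∈ Finset.range N, rademacher j t • x j

/-- `x` is almost unconditionally summable: its Rademacher series converges in norm
at almost every `t ∈ [0,1]`. -/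
def AlmostUncondSummable (x : ℕ → E) : Prop :=
  ∀ᵐ t ∂(volume.restrict (Set.Icc (0 : ℝ) 1)),
    ∃ s : E, Tendsto (radPartialSum x t) atTop (𝓝 s)

/-- The sum `∑_{j=1}^∞ r_j(t) x_j` of the Rademacher series: the limit of its partial sums. -/
noncomputable def radSum (x : ℕ → E) (t : ℝ) : E :=
  limUnder atTop (radPartialSum x t)

/-- `(∫₀¹ ‖∑ r_j(t) x_j‖² dt)^{1/2}`. -/
noncomputable def radNorm (x : ℕ → E) : ℝ :=
  Real.sqrt (∫ t in Set.Icc (0 : ℝ) 1, ‖radSum x t‖ ^ 2)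

/-- The finite section `(x_1, …, x_k, 0, 0, …)`. -/
def finiteSection (k : ℕ) (x : ℕ → E) : ℕ → E := fun j => if j < k then x j else 0

end Rademacher

/-- A rule that assigns to each Banach space `E` over `𝕜` a set of `E`-valued sequences and
a real-valued function on sequences, the candidate norm; see `IsSequenceClass`. -/
structure SequenceRule (𝕜 : Type) [RCLike 𝕜] where
  /-- the sequences that belong to `X(E)` -/
  carrier : ∀ (E : Type u) [NormedAddCommGroup E] [NormedSpace 𝕜 E] [CompleteSpace E],
    Set (ℕ → E)
  /-- `‖·‖_{X(E)}`; only its values on `X(E)` matter -/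
  norm : ∀ (E : Type u) [NormedAddCommGroup E] [NormedSpace 𝕜 E] [CompleteSpace E],
    (ℕ → E) → ℝ

/-- `X` is a sequence class: every `X(E)` is a vector subspace of `E^ℕ` and a Banach space
under its norm, `c₀₀(E) ⊆ X(E)`, `X(E) ⊆ ℓ_∞(E)` with `‖·‖_∞ ≤ ‖·‖_{X(E)}`, and
`‖e_j‖_{X(𝕜)} = 1` for all `j` (with `𝕜` lifted to the universe of the Banach spaces). -/
structure IsSequenceClass {𝕜 : Type} [RCLike 𝕜] (X : SequenceRule.{u} 𝕜) : Prop where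
  add_mem : ∀ (E : Type u) [NormedAddCommGroup E] [NormedSpace 𝕜 E] [CompleteSpace E],
    ∀ x ∈ X.carrier E, ∀ y ∈ X.carrier E, x + y ∈ X.carrier E
  smul_mem : ∀ (E : Type u) [NormedAddCommGroup E] [NormedSpace 𝕜 E] [CompleteSpace E],
    ∀ (c : 𝕜), ∀ x ∈ X.carrier E, c • x ∈ X.carrier E
  norm_add_le : ∀ (E : Type u) [NormedAddCommGroup E] [NormedSpace 𝕜 E] [CompleteSpace E],
    ∀ x ∈ X.carrier E, ∀ y ∈ X.carrier E, X.norm E (x + y) ≤ X.norm E x + X.norm E y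
  norm_smul : ∀ (E : Type u) [NormedAddCommGroup E] [NormedSpace 𝕜 E] [CompleteSpace E],
    ∀ (c : 𝕜), ∀ x ∈ X.carrier E, X.norm E (c • x) = ‖c‖ * X.norm E x
  eq_zero_of_norm : ∀ (E : Type u) [NormedAddCommGroup E] [NormedSpace 𝕜 E] [CompleteSpace E],
    ∀ x ∈ X.carrier E, X.norm E x = 0 → x = 0
  complete : ∀ (E : Type u) [NormedAddCommGroup E] [NormedSpace 𝕜 E] [CompleteSpace E],
    ∀ s : ℕ → ℕ → E, (∀ i, s i ∈ X.carrier E) →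
      (∀ ε > 0, ∃ N, ∀ i ≥ N, ∀ k ≥ N, X.norm E (s i - s k) < ε) →
      ∃ x ∈ X.carrier E, Tendsto (fun i => X.norm E (s i - x)) atTop (𝓝 0)
  finite_mem : ∀ (E : Type u) [NormedAddCommGroup E] [NormedSpace 𝕜 E] [CompleteSpace E],
    ∀ x : ℕ → E, (∃ N, ∀ j ≥ N, x j = 0) → x ∈ X.carrier E
  norm_coord_le : ∀ (E : Type u) [NormedAddCommGroup E] [NormedSpace 𝕜 E] [CompleteSpace E],
    ∀ x ∈ X.carrier E, ∀ j, ‖x j‖ ≤ X.norm E x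
  norm_single : ∀ j : ℕ,
    X.norm (ULift.{u} 𝕜) (Pi.single j (ULift.up (1 : 𝕜))) = 1

/-- The map `Â` that `A` induces on sequences: `Â(x¹, …, xⁿ)_j = A(x¹_j, …, xⁿ_j)`. -/
def inducedSeq {𝕜 : Type} [RCLike 𝕜] {n : ℕ} {E : Fin n → Type u} {F : Type u}
    [∀ m, NormedAddCommGroup (E m)] [∀ m, NormedSpace 𝕜 (E m)]
    [NormedAddCommGroup F] [NormedSpace 𝕜 F]
    (A : ContinuousMultilinearMap 𝕜 E F) (x : ∀ m, ℕ → E m) : ℕ → F :=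
  fun j => A (fun m => x m j)

/-- `X` is a multilinearly stable sequence class: for all `n ≥ 1` and every continuous
`n`-linear `A` between Banach spaces, `Â` maps `X(E₁) × ⋯ × X(Eₙ)` into `X(F)`, and its norm,
which is the least `C ≥ 0` with `‖Â(x)‖ ≤ C ‖x¹‖ ⋯ ‖xⁿ‖` for all `x`, equals `‖A‖`. -/
def MultilinearlyStable {𝕜 : Type} [RCLike 𝕜] (X : SequenceRule.{u} 𝕜) : Prop :=
  IsSequenceClass X ∧
  ∀ (n : ℕ), 1 ≤ n → ∀ (E : Fin n → Type u) (F : Type u)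
    [∀ m, NormedAddCommGroup (E m)] [∀ m, NormedSpace 𝕜 (E m)] [∀ m, CompleteSpace (E m)]
    [NormedAddCommGroup F] [NormedSpace 𝕜 F] [CompleteSpace F]
    (A : ContinuousMultilinearMap 𝕜 E F),
    (∀ x : (∀ m, ℕ → E m), (∀ m, x m ∈ X.carrier (E m)) → inducedSeq A x ∈ X.carrier F) ∧
    IsLeast {C : ℝ | 0 ≤ C ∧ ∀ x : (∀ m, ℕ → E m), (∀ m, x m ∈ X.carrier (E m)) →
      X.norm F (inducedSeq A x) ≤ C * ∏ m, X.norm (E m) (x m)} ‖A‖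

/-- `Rad(·)`: the almost unconditionally summable sequences with the `L²`-Rademacher norm. -/
noncomputable def Rad (𝕜 : Type) [RCLike 𝕜] : SequenceRule.{u} 𝕜 where
  carrier E _ _ _ :=
    letI : NormedSpace ℝ E := NormedSpace.restrictScalars ℝ 𝕜 E
    {x | AlmostUncondSummable x}
  norm E _ _ _ x :=
    letI : NormedSpace ℝ E := NormedSpace.restrictScalars ℝ 𝕜 E
    radNorm x

/-- `RAD(·)`: the sequences whose finite sections have bounded `Rad` norms, with the supremum
of these norms. -/
noncomputable def RAD (𝕜 : Type) [RCLike 𝕜] : SequenceRule.{u} 𝕜 where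
  carrier E _ _ _ :=
    {x | BddAbove (Set.range fun k : ℕ => (Rad 𝕜).norm E (finiteSection k x))}
  norm E _ _ _ x := ⨆ k : ℕ, (Rad 𝕜).norm E (finiteSection k x)

/-!
Write `S_N` for the partial sums of the Rademacher series of `x`. Everything is expressed through
the extended norm `radNormSup x = sup_N ‖S_N‖`, the norms being those of `L²([0,1]; E)`. It equals
the norm of `RAD(E)`, whose elements are the sequences where it is finite. The elements of
`Rad(E)` turn out to be the sequences whose tails tend to `0` for it, and there it is the norm of
`Rad(E)`. With this description both spaces are complete, since the two conditions define closed
subspaces and the norm dominates every coordinate.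

*Independence.* All facts about the Rademacher functions come from one self-similarity,
`lintegral_rademacher_cons`: the law of `(r_1, r_2, …)` is the mean of the laws of
`(1, r_1, r_2, …)` and `(-1, r_1, r_2, …)`. Statements about partial sums then follow by induction
on their length: invariance under changes of sign, hence the contraction
`radNormUpTo_indicator_le`, a maximal inequality, and an inequality of Kahane type.

*Almost sure convergence against `L²`.* If the series converges almost surely, its tails are
uniformly small in probability. Stopping the partial sums when their norm first exceeds `η`
gives `𝔼 (‖S_N‖ - η)₊² ≤ 𝔼 ‖S_N‖² · P(max_{k ≤ N} ‖S_k‖ > η)` (`lintegral_sub_sq_le`), so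
`𝔼 ‖S_N‖² ≤ 4 η²` once this probability is at most `1/4`; in particular the sum is square
integrable. Conversely, the maximal inequality turns `L²` convergence into almost sure convergence.

*Multilinear stability.* For operators `T_j` and vectors `x_j`,
`∑ ε_j T_j x_j = 𝔼 (∑ ε_j r_j T_j) (∑ r_k x_k)`, so Cauchy–Schwarz bounds the norm by
`‖∑ r_j T_j‖ ‖∑ r_j x_j‖` in `L²`, uniformly in the signs `ε` (`enorm_signSum_apply_le`). Taking
`T_j = A(·, x²_j, …, xⁿ_j)` and inducting on `n` gives the bound with constant `‖A‖`, which
sequences with one nonzero term show to be optimal.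
-/

/-! ### Self-similarity of the Rademacher functions -/

/-- Lebesgue measure on `[0,1]`, the probability space on which the Rademacher functions live. -/
noncomputable abbrev unitMeasure : Measure ℝ := volume.restrict (Set.Icc (0 : ℝ) 1)

instance isProbabilityMeasure_unitMeasure : IsProbabilityMeasure unitMeasure :=
  ⟨by simp [unitMeasure]⟩

/-- The sequence `(c, ε 0, ε 1, …)`. -/
def signCons (c : ℝ) (ε : ℕ → ℝ) : ℕ → ℝ
  | 0 => c
  | j + 1 => ε j

lemma measurable_rademacher (j : ℕ) : Measurable (rademacher j) := by
  have h : Measurable Real.sign := by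
    have : Real.sign = fun r : ℝ => if r < 0 then (-1 : ℝ) else if 0 < r then 1 else 0 := by
      ext r; rfl
    rw [this]
    exact Measurable.ite measurableSet_Iio measurable_const
      (Measurable.ite measurableSet_Ioi measurable_const measurable_const)
  exact h.comp (Real.measurable_sin.comp (measurable_const.mul measurable_id))

lemma rademacher_left_half {t : ℝ} (ht : t ∈ Set.Ioo (0 : ℝ) 1) :
    (fun j => rademacher j (t * 2⁻¹)) = signCons 1 (fun j => rademacher j t) := by
  ext j
  cases j with
  | zero =>
    have : 0 < Real.sin (Real.pi * t) :=
      Real.sin_pos_of_pos_of_lt_pi (mul_pos Real.pi_pos ht.1)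
        (by nlinarith [Real.pi_pos, ht.2])
    simp only [rademacher, signCons, zero_add, pow_one]
    rw [show 2 * Real.pi * (t * 2⁻¹) = Real.pi * t by ring, Real.sign_of_pos this]
  | succ j =>
    simp only [rademacher, signCons]
    congr 2; ring

lemma rademacher_right_half {t : ℝ} (ht : t ∈ Set.Ioo (0 : ℝ) 1) :
    (fun j => rademacher j (t * 2⁻¹ + 2⁻¹)) = signCons (-1) (fun j => rademacher j t) := by
  ext j
  cases j with
  | zero =>
    have : 0 < Real.sin (Real.pi * t) :=
      Real.sin_pos_of_pos_of_lt_pi (mul_pos Real.pi_pos ht.1)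
        (by nlinarith [Real.pi_pos, ht.2])
    simp only [rademacher, signCons, zero_add, pow_one]
    rw [show 2 * Real.pi * (t * 2⁻¹ + 2⁻¹) = Real.pi * t + Real.pi by ring, Real.sin_add_pi,
      Real.sign_of_neg (by linarith)]
  | succ j =>
    simp only [rademacher, signCons]
    congr 1
    rw [show 2 ^ (j + 1 + 1) * Real.pi * (t * 2⁻¹ + 2⁻¹)
      = 2 ^ (j + 1) * Real.pi * t + ((2 ^ j : ℕ) : ℝ) * (2 * Real.pi) by push_cast; ring,
      Real.sin_add_nat_mul_two_pi]

lemma lintegral_unitMeasure_halves (g : ℝ → ENNReal) :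
    ∫⁻ t, g t ∂unitMeasure = 2⁻¹ * (∫⁻ t, g (t * 2⁻¹) ∂unitMeasure
      + ∫⁻ t, g (t * 2⁻¹ + 2⁻¹) ∂unitMeasure) := by
  have key : ∀ b : ℝ, ∫⁻ t in Set.Icc b (2⁻¹ + b), g t
      = 2⁻¹ * ∫⁻ t, g (t * 2⁻¹ + b) ∂unitMeasure := by
    intro b
    have himg : (fun t : ℝ => t * 2⁻¹ + b) '' Set.Icc 0 1 = Set.Icc b (2⁻¹ + b) := by
      rw [← Set.image_image (fun x => x + b) (fun t : ℝ => t * 2⁻¹),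
        Set.image_mul_right_Icc zero_le_one (by norm_num)]
      simp
    rw [← himg, lintegral_image_eq_lintegral_abs_deriv_mul (f' := fun _ => 2⁻¹) measurableSet_Icc
      (fun x _ => by
        simpa using (((hasDerivAt_id x).mul_const (2⁻¹ : ℝ)).add_const b).hasDerivWithinAt)
      (fun x _ y _ h => by simpa using h)]
    rw [lintegral_const_mul' _ _ ENNReal.ofReal_ne_top]
    congr 1
    rw [abs_of_pos (by norm_num), ENNReal.ofReal_inv_of_pos (by norm_num)]
    simp
  have hsplit : Set.Icc (0 : ℝ) 1 = Set.Icc 0 2⁻¹ ∪ Set.Ioc 2⁻¹ 1 :=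
    (Set.Icc_union_Ioc_eq_Icc (by norm_num) (by norm_num)).symm
  have h0 := key 0
  have h1 := key 2⁻¹
  simp only [add_zero] at h0
  rw [show (2⁻¹ + 2⁻¹ : ℝ) = 1 by norm_num] at h1
  rw [mul_add, ← h0, ← h1, unitMeasure, hsplit, lintegral_union measurableSet_Ioc,
    restrict_Ioc_eq_restrict_Icc]
  exact Set.disjoint_left.2 fun x hx hy => not_lt.2 hx.2 hy.1

/-- The Rademacher functions are independent symmetric signs: conditionally on the first one,
the others are distributed as the whole sequence. This is the self-similarity
`r_{j+1}(t / 2) = r_{j+1}((t + 1) / 2) = r_j(t)`; it holds for every functional `G`,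
measurable or not. -/
lemma lintegral_rademacher_cons (G : (ℕ → ℝ) → ENNReal) :
    ∫⁻ t, G (fun j => rademacher j t) ∂unitMeasure
      = 2⁻¹ * (∫⁻ t, G (signCons 1 fun j => rademacher j t) ∂unitMeasure
        + ∫⁻ t, G (signCons (-1) fun j => rademacher j t) ∂unitMeasure) := by
  have hIoo : ∀ᵐ t ∂unitMeasure, t ∈ Set.Ioo (0 : ℝ) 1 := by
    rw [unitMeasure, ← restrict_Ioo_eq_restrict_Icc]
    exact ae_restrict_mem measurableSet_Ioo
  rw [lintegral_unitMeasure_halves]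
  congr 2 <;> refine lintegral_congr_ae ?_ <;> filter_upwards [hIoo] with t ht
  · rw [rademacher_left_half ht]
  · rw [rademacher_right_half ht]

lemma ae_rademacher_eq_one_or_neg_one :
    ∀ᵐ t ∂unitMeasure, ∀ j, rademacher j t = 1 ∨ rademacher j t = -1 := by
  rw [ae_all_iff]
  intro j
  set B : Set ℝ := {s : ℝ | s ≠ 1 ∧ s ≠ -1} with hB
  have hBm : MeasurableSet B := by
    have : B = {1}ᶜ ∩ {-1}ᶜ := by ext; simp [hB]
    rw [this]
    exact (measurableSet_singleton _).compl.inter (measurableSet_singleton _).compl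
  have h : ∫⁻ t, B.indicator 1 (rademacher j t) ∂unitMeasure = 0 := by
    induction j with
    | zero =>
      rw [lintegral_rademacher_cons (fun ε => B.indicator 1 (ε 0))]
      simp [signCons, hB]
    | succ j ih =>
      rw [lintegral_rademacher_cons (fun ε => B.indicator 1 (ε (j + 1)))]
      simp only [signCons]
      rw [ih]
      simp
  rw [lintegral_eq_zero_iff (f := fun t => B.indicator 1 (rademacher j t))
    ((measurable_one.indicator hBm).comp (measurable_rademacher j))] at h
  filter_upwards [h] with t ht
  by_contra hcon
  push Not at hcon
  have hmem : rademacher j t ∈ B := hcon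
  simp [hmem] at ht

/-! ### Partial sums of Rademacher series and their second moments -/

section Sums

variable {E : Type*} [NormedAddCommGroup E] [NormedSpace ℝ E]

/-- The signed sum `∑_{j < N} ε_j x_j`. -/
def signSum (ε : ℕ → ℝ) (x : ℕ → E) (N : ℕ) : E := ∑ j ∈ Finset.range N, ε j • x j

lemma signSum_signCons (c : ℝ) (ε : ℕ → ℝ) (x : ℕ → E) (N : ℕ) :
    signSum (signCons c ε) x (N + 1) = c • x 0 + signSum ε (fun j => x (j + 1)) N := by
  simp [signSum, Finset.sum_range_succ', signCons, add_comm]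

lemma radPartialSum_eq_signSum (x : ℕ → E) (t : ℝ) (N : ℕ) :
    radPartialSum x t N = signSum (fun j => rademacher j t) x N := rfl

@[simp] lemma radPartialSum_zero (x : ℕ → E) (t : ℝ) : radPartialSum x t 0 = 0 := by
  simp [radPartialSum]

lemma radPartialSum_add (x y : ℕ → E) (t : ℝ) (N : ℕ) :
    radPartialSum (x + y) t N = radPartialSum x t N + radPartialSum y t N := by
  simp [radPartialSum, Finset.sum_add_distrib]

lemma radPartialSum_smul {𝕜 : Type*} [RCLike 𝕜] [NormedSpace 𝕜 E] [SMulCommClass ℝ 𝕜 E]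
    (c : 𝕜) (x : ℕ → E) (t : ℝ) (N : ℕ) :
    radPartialSum (c • x) t N = c • radPartialSum x t N := by
  simp only [radPartialSum, Finset.smul_sum, Pi.smul_apply]
  exact Finset.sum_congr rfl fun j _ => smul_comm _ _ _

lemma stronglyMeasurable_radPartialSum (x : ℕ → E) (N : ℕ) :
    StronglyMeasurable (fun t => radPartialSum x t N) := by
  unfold radPartialSum
  exact Finset.stronglyMeasurable_fun_sum _ fun j _ =>
    (measurable_rademacher j).stronglyMeasurable.smul_const _

lemma aestronglyMeasurable_radPartialSum (x : ℕ → E) (N : ℕ) :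
    AEStronglyMeasurable (fun t => radPartialSum x t N) unitMeasure :=
  (stronglyMeasurable_radPartialSum x N).aestronglyMeasurable

lemma lintegral_radPartialSum_succ (Φ : E → ENNReal) (x : ℕ → E) (N : ℕ) :
    ∫⁻ t, Φ (radPartialSum x t (N + 1)) ∂unitMeasure
      = 2⁻¹ * (∫⁻ t, Φ (x 0 + radPartialSum (fun j => x (j + 1)) t N) ∂unitMeasure
        + ∫⁻ t, Φ (-x 0 + radPartialSum (fun j => x (j + 1)) t N) ∂unitMeasure) := by
  have h := lintegral_rademacher_cons (fun ε => Φ (signSum ε x (N + 1)))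
  simpa only [signSum_signCons, one_smul, neg_smul, ← radPartialSum_eq_signSum] using h

lemma lintegral_radPartialSum_signs (Φ : E → ENNReal) (x : ℕ → E) (N : ℕ) {ε : ℕ → ℝ}
    (hε : ∀ j, ε j = 1 ∨ ε j = -1) :
    ∫⁻ t, Φ (radPartialSum (fun j => ε j • x j) t N) ∂unitMeasure
      = ∫⁻ t, Φ (radPartialSum x t N) ∂unitMeasure := by
  induction N generalizing Φ x ε with
  | zero => simp
  | succ N ih =>
    rw [lintegral_radPartialSum_succ, lintegral_radPartialSum_succ]
    have h := fun a : E => ih (fun v => Φ (a + v)) (fun j => x (j + 1)) (fun j => hε (j + 1))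
    rw [h, h]
    rcases hε 0 with h0 | h0
    · simp [h0]
    · simp only [h0, neg_smul, one_smul, neg_neg]
      rw [add_comm]

lemma enorm_le_half_add {u v w : E} (h : u + v = (2 : ℝ) • w) :
    ‖w‖ₑ ≤ 2⁻¹ * (‖u‖ₑ + ‖v‖ₑ) := by
  have hw : (2 : ENNReal) * ‖w‖ₑ ≤ ‖u‖ₑ + ‖v‖ₑ := by
    have h2 : ‖(2 : ℝ) • w‖ₑ = 2 * ‖w‖ₑ := by
      rw [enorm_smul]; congr 1; simp [Real.enorm_eq_ofReal]
    rw [← h2, ← h]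
    exact enorm_add_le u v
  calc ‖w‖ₑ = 2⁻¹ * (2 * ‖w‖ₑ) := by
        rw [← mul_assoc, ENNReal.inv_mul_cancel (by simp) (by simp), one_mul]
    _ ≤ _ := by gcongr

/-- The `L²([0,1]; E)` norm of the `N`-th partial sum of the Rademacher series of `x`. -/
noncomputable def radNormUpTo (N : ℕ) (x : ℕ → E) : ENNReal :=
  eLpNorm (fun t => radPartialSum x t N) 2 unitMeasure

lemma radNormUpTo_sq (N : ℕ) (x : ℕ → E) :
    radNormUpTo N x ^ 2 = ∫⁻ t, ‖radPartialSum x t N‖ₑ ^ 2 ∂unitMeasure := by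
  have := eLpNorm_nnreal_pow_eq_lintegral (f := fun t => radPartialSum x t N)
    (μ := unitMeasure) (p := 2) (by simp)
  simpa [radNormUpTo] using this

lemma radNormUpTo_add_le (N : ℕ) (x y : ℕ → E) :
    radNormUpTo N (x + y) ≤ radNormUpTo N x + radNormUpTo N y := by
  unfold radNormUpTo
  simp only [radPartialSum_add]
  exact eLpNorm_add_le (aestronglyMeasurable_radPartialSum x N)
    (aestronglyMeasurable_radPartialSum y N) (by norm_num)

lemma radNormUpTo_smul {𝕜 : Type*} [RCLike 𝕜] [NormedSpace 𝕜 E] [SMulCommClass ℝ 𝕜 E]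
    (N : ℕ) (c : 𝕜) (x : ℕ → E) :
    radNormUpTo N (c • x) = ‖c‖ₑ * radNormUpTo N x := by
  unfold radNormUpTo
  simp only [radPartialSum_smul]
  exact eLpNorm_const_smul c _ _ _

lemma radNormUpTo_congr {N : ℕ} {x y : ℕ → E} (h : ∀ j < N, x j = y j) :
    radNormUpTo N x = radNormUpTo N y := by
  unfold radNormUpTo radPartialSum
  congr 1; ext t
  exact Finset.sum_congr rfl fun j hj => by rw [h j (Finset.mem_range.1 hj)]

lemma radNormUpTo_signs (N : ℕ) (x : ℕ → E) {ε : ℕ → ℝ} (hε : ∀ j, ε j = 1 ∨ ε j = -1) :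
    radNormUpTo N (fun j => ε j • x j) = radNormUpTo N x := by
  have h : radNormUpTo N (fun j => ε j • x j) ^ 2 = radNormUpTo N x ^ 2 := by
    rw [radNormUpTo_sq, radNormUpTo_sq]
    exact lintegral_radPartialSum_signs (fun v => ‖v‖ₑ ^ 2) x N hε
  exact (ENNReal.pow_right_strictMono (n := 2) (by norm_num)).injective h

/-- Replacing some coordinates by `0` does not increase the norm, because the result is the mean
of `x` and of a sequence that differs from `x` by signs. -/
lemma radNormUpTo_indicator_le (N : ℕ) (x : ℕ → E) (s : Set ℕ) :
    radNormUpTo N (s.indicator x) ≤ radNormUpTo N x := by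
  classical
  set ε : ℕ → ℝ := fun j => if j ∈ s then 1 else -1 with hε
  have hsplit : s.indicator x = (2⁻¹ : ℝ) • (x + fun j => ε j • x j) := by
    ext j
    by_cases hj : j ∈ s
    · simp [hε, hj, ← two_smul ℝ (x j), smul_smul]
    · simp [hε, hj]
  have h2 : ‖(2⁻¹ : ℝ)‖ₑ = 2⁻¹ := by
    rw [Real.enorm_eq_ofReal (by norm_num), ENNReal.ofReal_inv_of_pos (by norm_num)]
    simp
  rw [hsplit, radNormUpTo_smul, h2]
  calc (2⁻¹ : ENNReal) * radNormUpTo N (x + fun j => ε j • x j)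
      ≤ 2⁻¹ * (radNormUpTo N x + radNormUpTo N x) := by
        gcongr
        refine (radNormUpTo_add_le _ _ _).trans_eq ?_
        rw [radNormUpTo_signs N x fun j => by by_cases hj : j ∈ s <;> simp [hε, hj]]
    _ = radNormUpTo N x := by
        rw [← two_mul, ← mul_assoc, ENNReal.inv_mul_cancel (by simp) (by simp), one_mul]

lemma radNormUpTo_of_forall_ge_eq_zero {M N : ℕ} (hMN : M ≤ N) {x : ℕ → E}
    (hx : ∀ j, M ≤ j → x j = 0) : radNormUpTo N x = radNormUpTo M x := by
  unfold radNormUpTo radPartialSum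
  congr 1; ext t
  refine (Finset.sum_subset (Finset.range_subset_range.2 hMN) fun j _ hj => ?_).symm
  rw [hx j (by simpa using hj), smul_zero]

lemma radNormUpTo_mono (x : ℕ → E) : Monotone fun N => radNormUpTo N x := by
  intro M N hMN
  calc radNormUpTo M x = radNormUpTo M ((Set.Iio M).indicator x) :=
        radNormUpTo_congr fun j hj => by simp [hj]
    _ = radNormUpTo N ((Set.Iio M).indicator x) :=
        (radNormUpTo_of_forall_ge_eq_zero hMN fun j hj => by simp [hj]).symm
    _ ≤ radNormUpTo N x := radNormUpTo_indicator_le _ _ _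

lemma radNormUpTo_single {N j : ℕ} (hj : j < N) (v : E) :
    radNormUpTo N (Pi.single j v) = ‖v‖ₑ := by
  have hsum : ∀ t, radPartialSum (Pi.single j v) t N = rademacher j t • v := by
    intro t
    unfold radPartialSum
    rw [Finset.sum_eq_single j (fun i _ hi => by simp [hi])
      (fun h => absurd (Finset.mem_range.2 hj) h)]
    simp
  unfold radNormUpTo
  calc eLpNorm (fun t => radPartialSum (Pi.single j v) t N) 2 unitMeasure
      = eLpNorm (fun _ : ℝ => v) 2 unitMeasure := by
        refine eLpNorm_congr_norm_ae ?_
        filter_upwards [ae_rademacher_eq_one_or_neg_one] with t ht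
        rw [hsum]
        rcases ht j with h | h <;> simp [h]
    _ = ‖v‖ₑ := by simp [eLpNorm_const]

lemma enorm_le_radNormUpTo {N j : ℕ} (hj : j < N) (x : ℕ → E) : ‖x j‖ₑ ≤ radNormUpTo N x := by
  rw [← radNormUpTo_single hj (x j), show Pi.single j (x j) = ({j} : Set ℕ).indicator x by
    ext i; by_cases h : i = j
    · subst h; simp
    · simp [h]]
  exact radNormUpTo_indicator_le _ _ _

lemma radNormUpTo_le_sum (N : ℕ) (x : ℕ → E) :
    radNormUpTo N x ≤ ∑ j ∈ Finset.range N, ‖x j‖ₑ := by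
  have h := eLpNorm_le_of_ae_enorm_bound (μ := unitMeasure) (p := 2)
    (f := fun t => radPartialSum x t N) (C := ∑ j ∈ Finset.range N, ‖x j‖ₑ) (by
      filter_upwards [ae_rademacher_eq_one_or_neg_one] with t ht
      refine (enorm_sum_le _ _).trans (Finset.sum_le_sum fun j _ => ?_)
      rcases ht j with h | h <;> simp [h])
  simpa [radNormUpTo] using h

lemma radNormUpTo_lt_top (N : ℕ) (x : ℕ → E) : radNormUpTo N x < ⊤ :=
  (radNormUpTo_le_sum N x).trans_lt (ENNReal.sum_lt_top.2 fun _ _ => enorm_lt_top)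

end Sums

/-! ### Bilinear and multilinear estimates -/

section Bilinear

variable {E F : Type*} [NormedAddCommGroup E] [NormedSpace ℝ E] [NormedAddCommGroup F]
  [NormedSpace ℝ F]

/-- Orthonormality of the Rademacher functions, in the form of Jensen's inequality for
`S b + ∑ T_j x_j = 𝔼 (S + ∑ r_j T_j) (b + ∑ r_k x_k)`. -/
lemma enorm_sum_apply_le_lintegral (T : ℕ → E →L[ℝ] F) (x : ℕ → E) (S : E →L[ℝ] F) (b : E)
    (N : ℕ) :
    ‖S b + ∑ j ∈ Finset.range N, T j (x j)‖ₑ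
      ≤ ∫⁻ t, ‖(S + radPartialSum T t N) (b + radPartialSum x t N)‖ₑ ∂unitMeasure := by
  induction N generalizing T x S b with
  | zero => simp
  | succ N ih =>
    have h := lintegral_rademacher_cons
      (fun ε => ‖(S + signSum ε T (N + 1)) (b + signSum ε x (N + 1))‖ₑ)
    simp only [signSum_signCons, ← radPartialSum_eq_signSum, ← add_assoc] at h
    rw [h]
    have h' := fun c : ℝ =>
      ih (fun j => T (j + 1)) (fun j => x (j + 1)) (S + c • T 0) (b + c • x 0)
    refine le_trans ?_ (mul_le_mul_right (add_le_add (h' 1) (h' (-1))) 2⁻¹)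
    apply enorm_le_half_add
    rw [Finset.sum_range_succ']
    simp only [one_smul, neg_smul, add_apply, neg_apply, map_add, map_neg, two_smul]
    abel

/-- Cauchy–Schwarz for `∑ ε_j T_j x_j = 𝔼 (∑ ε_j r_j T_j) (∑ r_k x_k)`: the bound is uniform in
the signs. -/
lemma enorm_signSum_apply_le (T : ℕ → E →L[ℝ] F) (x : ℕ → E) (N : ℕ) {ε : ℕ → ℝ}
    (hε : ∀ j, ε j = 1 ∨ ε j = -1) :
    ‖signSum ε (fun j => T j (x j)) N‖ₑ ≤ radNormUpTo N T * radNormUpTo N x := by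
  have h := enorm_sum_apply_le_lintegral (fun j => ε j • T j) x 0 0 N
  simp only [zero_add, map_zero, smul_apply] at h
  refine h.trans ?_
  rw [← eLpNorm_one_eq_lintegral_enorm, ← radNormUpTo_signs N T hε]
  have := eLpNorm_le_eLpNorm_mul_eLpNorm_of_nnnorm (p := 2) (q := 2) (r := 1)
    (aestronglyMeasurable_radPartialSum (fun j => ε j • T j) N)
    (aestronglyMeasurable_radPartialSum x N) (fun S v => S v) 1
    (ae_of_all _ fun t => by rw [one_mul]; exact ContinuousLinearMap.le_opNNNorm _ _)
  simpa [radNormUpTo] using this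

lemma radNormUpTo_apply_le (T : ℕ → E →L[ℝ] F) (x : ℕ → E) (N : ℕ) :
    radNormUpTo N (fun j => T j (x j)) ≤ radNormUpTo N T * radNormUpTo N x := by
  have h := eLpNorm_le_of_ae_enorm_bound (μ := unitMeasure) (p := 2)
    (f := fun t => radPartialSum (fun j => T j (x j)) t N) (by
      filter_upwards [ae_rademacher_eq_one_or_neg_one] with t ht
      exact enorm_signSum_apply_le T x N ht)
  simpa [radNormUpTo] using h

lemma radNormUpTo_clm_le (T : E →L[ℝ] F) (x : ℕ → E) (N : ℕ) :
    radNormUpTo N (fun j => T (x j)) ≤ ‖T‖ₑ * radNormUpTo N x := by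
  have hT : ∀ t, radPartialSum (fun j => T (x j)) t N = T (radPartialSum x t N) := by
    intro t; simp [radPartialSum]
  unfold radNormUpTo
  simp only [hT]
  exact eLpNorm_le_nnreal_smul_eLpNorm_of_ae_le_mul
    (ae_of_all _ fun t => ContinuousLinearMap.le_opNNNorm T _) 2

end Bilinear

/-- The `n`-linear estimate. For `n ≥ 2` it reduces to `n - 1` by viewing `A` as an
`(n - 1)`-linear map into the space of operators on the remaining factor. -/
lemma radNormUpTo_multilinear_le {n : ℕ} {E : Fin (n + 1) → Type u} {F : Type u}
    [∀ m, NormedAddCommGroup (E m)] [∀ m, NormedSpace ℝ (E m)]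
    [NormedAddCommGroup F] [NormedSpace ℝ F]
    (A : ContinuousMultilinearMap ℝ E F) (x : ∀ m, ℕ → E m) (N : ℕ) :
    radNormUpTo N (fun j => A fun m => x m j) ≤ ‖A‖ₑ * ∏ m, radNormUpTo N (x m) := by
  induction n generalizing F with
  | zero =>
    set T : E 0 →L[ℝ] F := A.curryLeft.flipMultilinear 0 with hT
    have hTA : ∀ v, T v = A (Fin.cons v 0) := fun v => rfl
    have hA : (fun j => A fun m => x m j) = fun j => T (x 0 j) := by
      ext j
      rw [hTA]
      congr 1; ext m
      obtain rfl : m = 0 := Fin.fin_one_eq_zero m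
      rfl
    rw [hA]
    refine (radNormUpTo_clm_le T (x 0) N).trans ?_
    simp only [Nat.reduceAdd, Finset.univ_unique, Fin.default_eq_zero, Finset.prod_singleton]
    gcongr
    refine enorm_le_iff_norm_le.2 (T.opNorm_le_bound (norm_nonneg _) fun v => ?_)
    rw [hTA]
    refine (A.le_opNorm _).trans_eq ?_
    simp
  | succ n ih =>
    set B := A.curryLeft.flipMultilinear with hB
    have hBA : (fun j => A fun m => x m j)
        = fun j => (B fun m : Fin (n + 1) => x m.succ j) (x 0 j) := by
      ext j
      change _ = A (Fin.cons (x 0 j) fun m : Fin (n + 1) => x m.succ j)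
      congr 1; ext m
      refine Fin.cases ?_ (fun i => ?_) m <;> rfl
    have hnorm : ‖B‖ ≤ ‖A‖ := by
      refine ContinuousMultilinearMap.opNorm_le_bound (norm_nonneg _) fun v =>
        ContinuousLinearMap.opNorm_le_bound _ (by positivity) fun w => ?_
      change ‖A (Fin.cons w v)‖ ≤ _
      refine (A.le_opNorm _).trans_eq ?_
      simp only [Fin.prod_univ_succ, Fin.cons_zero, Fin.cons_succ]; ring
    rw [hBA, Fin.prod_univ_succ]
    calc _ ≤ radNormUpTo N (fun j => B fun m : Fin (n + 1) => x m.succ j)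
          * radNormUpTo N (x 0) := radNormUpTo_apply_le _ _ _
      _ ≤ (‖B‖ₑ * ∏ m : Fin (n + 1), radNormUpTo N (x m.succ)) * radNormUpTo N (x 0) := by
          gcongr
          exact ih B (fun m => x m.succ)
      _ ≤ (‖A‖ₑ * ∏ m : Fin (n + 1), radNormUpTo N (x m.succ)) * radNormUpTo N (x 0) := by
          gcongr
          exact enorm_le_iff_norm_le.2 hnorm
      _ = _ := by ring

/-! ### Tails of sequences -/

/-- The tail `(0, …, 0, x_M, x_{M+1}, …)`. -/
noncomputable abbrev seqTail {E : Type*} [Zero E] (M : ℕ) (x : ℕ → E) : ℕ → E :=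
  (Set.Ici M).indicator x

lemma seqTail_of_ge {E : Type*} [Zero E] {M j : ℕ} (h : M ≤ j)
    (x : ℕ → E) : seqTail M x j = x j :=
  Set.indicator_of_mem (Set.mem_Ici.2 h) x

lemma seqTail_of_lt {E : Type*} [Zero E] {M j : ℕ} (h : j < M)
    (x : ℕ → E) : seqTail M x j = 0 :=
  Set.indicator_of_notMem (by simpa using h) x

/-! ### Stopping and maximal inequalities -/

section Convergence

variable {E : Type*} [NormedAddCommGroup E] [NormedSpace ℝ E]

/-- By symmetry, the second moment of `∑_{j ≤ N} r_j x_j` does not change when the first sign is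
fixed. -/
lemma lintegral_shift_sq (x : ℕ → E) (N : ℕ) :
    (∫⁻ t, ‖x 0 + radPartialSum (fun j => x (j + 1)) t N‖ₑ ^ 2 ∂unitMeasure
      = radNormUpTo (N + 1) x ^ 2) ∧
    (∫⁻ t, ‖-x 0 + radPartialSum (fun j => x (j + 1)) t N‖ₑ ^ 2 ∂unitMeasure
      = radNormUpTo (N + 1) x ^ 2) := by
  have hflip : ∫⁻ t, ‖-x 0 + radPartialSum (fun j => x (j + 1)) t N‖ₑ ^ 2 ∂unitMeasure
      = ∫⁻ t, ‖x 0 + radPartialSum (fun j => x (j + 1)) t N‖ₑ ^ 2 ∂unitMeasure := by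
    have h := lintegral_radPartialSum_signs (fun v => ‖x 0 + v‖ₑ ^ 2) (fun j => x (j + 1)) N
      (ε := fun _ => -1) (fun _ => Or.inr rfl)
    rw [← h]
    refine lintegral_congr fun t => ?_
    congr 1
    rw [← enorm_neg]
    congr 1
    simp [radPartialSum, add_comm]
  have h := lintegral_radPartialSum_succ (fun v => ‖v‖ₑ ^ 2) x N
  rw [← radNormUpTo_sq, hflip, ← two_mul, ← mul_assoc,
    ENNReal.inv_mul_cancel (by simp) (by simp), one_mul] at h
  exact ⟨h.symm, hflip.trans h.symm⟩

lemma radNormUpTo_shift_le (x : ℕ → E) (N : ℕ) :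
    radNormUpTo N (fun j => x (j + 1)) ≤ radNormUpTo (N + 1) x := by
  refine le_trans (le_of_eq ?_) (radNormUpTo_indicator_le (N + 1) x (Set.Ici 1))
  have h := (lintegral_shift_sq ((Set.Ici 1).indicator x) N).1
  simp only [Set.mem_Ici, not_le, zero_lt_one, Set.indicator_of_notMem, le_add_iff_nonneg_left,
    zero_le, Set.indicator_of_mem, zero_add] at h
  rw [← radNormUpTo_sq] at h
  exact (ENNReal.pow_right_strictMono (n := 2) (by norm_num)).injective h

/-- The sign sequences for which one of the sums `a + ∑_{j < k} ε_j x_j`, `k ≤ N`, has norm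
in the set `I`. -/
def hitSet (I : Set ENNReal) (a : E) (x : ℕ → E) (N : ℕ) : Set (ℕ → ℝ) :=
  {ε | ∃ k ≤ N, ‖a + signSum ε x k‖ₑ ∈ I}

lemma signCons_mem_hitSet {I : Set ENNReal} {a : E} {x : ℕ → E} {N : ℕ} {c : ℝ} {ε : ℕ → ℝ}
    (h : ε ∈ hitSet I (a + c • x 0) (fun j => x (j + 1)) N) :
    signCons c ε ∈ hitSet I a x (N + 1) := by
  obtain ⟨k, hk, hI⟩ := h
  refine ⟨k + 1, by lia, ?_⟩
  rwa [signSum_signCons, ← add_assoc]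

lemma indicator_one_le_indicator_one {α β : Type*} {s : Set α} {t : Set β} {a : α} {b : β}
    (h : a ∈ s → b ∈ t) : s.indicator (1 : α → ENNReal) a ≤ t.indicator 1 b := by
  by_cases ha : a ∈ s
  · simp [ha, h ha]
  · simp [ha]

/-- Integrated form of Kahane's inequality, by stopping the partial sums when their norm first
exceeds `η`: what is added from that step on has second moment at most `𝔼 ‖S_N‖²`. -/
lemma lintegral_sub_sq_le (η q : ENNReal) (a : E) (ha : ‖a‖ₑ ≤ η) (x : ℕ → E) (N : ℕ)
    (hq : radNormUpTo N x ^ 2 ≤ q) :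
    ∫⁻ t, (‖a + radPartialSum x t N‖ₑ - η) ^ 2 ∂unitMeasure
      ≤ q * ∫⁻ t, (hitSet (Set.Ioi η) a x N).indicator 1 (fun j => rademacher j t)
        ∂unitMeasure := by
  induction N generalizing a x with
  | zero => simp [tsub_eq_zero_of_le ha]
  | succ N ih =>
    rw [lintegral_radPartialSum_succ (fun v => (‖a + v‖ₑ - η) ^ 2),
      lintegral_rademacher_cons (fun ε => (hitSet (Set.Ioi η) a x (N + 1)).indicator 1 ε)]
    have step : ∀ c : ℝ,
        ∫⁻ t, ‖c • x 0 + radPartialSum (fun j => x (j + 1)) t N‖ₑ ^ 2 ∂unitMeasure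
          = radNormUpTo (N + 1) x ^ 2 →
        ∫⁻ t, (‖a + (c • x 0 + radPartialSum (fun j => x (j + 1)) t N)‖ₑ - η) ^ 2 ∂unitMeasure
          ≤ q * ∫⁻ t, (hitSet (Set.Ioi η) a x (N + 1)).indicator 1
            (signCons c fun j => rademacher j t) ∂unitMeasure := by
      intro c hc
      -- Either the first step stays in the ball of radius `η`, and the induction continues from
      -- `a + c • x 0`, or the whole branch belongs to the hitting event.
      rcases le_or_gt ‖a + c • x 0‖ₑ η with hle | hgt
      · have h := ih (a + c • x 0) hle (fun j => x (j + 1))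
          (le_trans (by gcongr; exact radNormUpTo_shift_le x N) hq)
        simp only [add_assoc] at h
        refine h.trans ?_
        gcongr with t
        exact indicator_one_le_indicator_one signCons_mem_hitSet
      · have hone : ∀ t : ℝ, (hitSet (Set.Ioi η) a x (N + 1)).indicator (1 : (ℕ → ℝ) → ENNReal)
            (signCons c fun j => rademacher j t) = 1 := fun t =>
          Set.indicator_of_mem (signCons_mem_hitSet ⟨0, Nat.zero_le _, by
            simpa [signSum] using hgt⟩) _
        simp only [hone, lintegral_one, measure_univ, mul_one]
        refine le_trans (lintegral_mono fun t => ?_) (hc.trans_le hq)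
        gcongr
        rw [tsub_le_iff_right, add_comm _ η]
        exact (enorm_add_le _ _).trans (by gcongr)
    have h1 := step 1 (by simpa using (lintegral_shift_sq x N).1)
    have h2 := step (-1) (by simpa using (lintegral_shift_sq x N).2)
    simp only [one_smul, neg_smul] at h1 h2
    calc _ ≤ 2⁻¹ * (_ + _) := mul_le_mul_right (add_le_add h1 h2) _
      _ = _ := by ring

lemma enorm_le_lintegral_add_radPartialSum (a : E) (x : ℕ → E) (N : ℕ) :
    ‖a‖ₑ ≤ ∫⁻ t, ‖a + radPartialSum x t N‖ₑ ∂unitMeasure := by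
  induction N generalizing a x with
  | zero => simp
  | succ N ih =>
    rw [lintegral_radPartialSum_succ (fun v => ‖a + v‖ₑ)]
    simp only [← add_assoc]
    refine le_trans (enorm_le_half_add ?_) (mul_le_mul_right (add_le_add
      (ih (a + x 0) (fun j => x (j + 1))) (ih (a + -x 0) (fun j => x (j + 1)))) _)
    rw [two_smul]; abel

/-- Doob's weak-type maximal inequality for the submartingale `‖a + S_k‖`. -/
lemma mul_lintegral_hitSet_le (η : ENNReal) (a : E) (x : ℕ → E) (N : ℕ) :
    η * ∫⁻ t, (hitSet (Set.Ici η) a x N).indicator 1 (fun j => rademacher j t) ∂unitMeasure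
      ≤ ∫⁻ t, ‖a + radPartialSum x t N‖ₑ ∂unitMeasure := by
  induction N generalizing a x with
  | zero =>
    simp only [radPartialSum_zero, add_zero, lintegral_const, measure_univ, mul_one]
    by_cases ha : η ≤ ‖a‖ₑ
    · refine (mul_le_of_le_one_right' ?_).trans ha
      refine (lintegral_mono (g := fun _ => 1) fun t => ?_).trans (by simp)
      exact Set.indicator_le_self' (fun _ _ => zero_le_one) _
    · have : hitSet (Set.Ici η) a x 0 = ∅ := by
        ext ε; simpa [hitSet, signSum] using ha
      simp [this]
  | succ N ih =>
    by_cases ha : η ≤ ‖a‖ₑ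
    · refine le_trans ?_ (ha.trans (enorm_le_lintegral_add_radPartialSum a x (N + 1)))
      refine mul_le_of_le_one_right' ?_
      refine (lintegral_mono (g := fun _ => 1) fun t => ?_).trans (by simp)
      exact Set.indicator_le_self' (fun _ _ => zero_le_one) _
    rw [lintegral_radPartialSum_succ (fun v => ‖a + v‖ₑ),
      lintegral_rademacher_cons (fun ε => (hitSet (Set.Ici η) a x (N + 1)).indicator 1 ε)]
    have step : ∀ c : ℝ,
        η * ∫⁻ t, (hitSet (Set.Ici η) a x (N + 1)).indicator 1
            (signCons c fun j => rademacher j t) ∂unitMeasure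
          ≤ ∫⁻ t, ‖a + (c • x 0 + radPartialSum (fun j => x (j + 1)) t N)‖ₑ ∂unitMeasure := by
      intro c
      simp only [← add_assoc]
      refine le_trans ?_ (ih (a + c • x 0) (fun j => x (j + 1)))
      gcongr with t
      refine indicator_one_le_indicator_one fun h => ?_
      obtain ⟨k, hk, hI⟩ := h
      cases k with
      | zero => exact absurd (by simpa [signSum] using hI) ha
      | succ k =>
        refine ⟨k, by lia, ?_⟩
        rwa [signSum_signCons, ← add_assoc] at hI
    have h1 := step 1
    have h2 := step (-1)
    simp only [one_smul, neg_smul] at h1 h2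
    calc _ = 2⁻¹ * (_ + _) := by ring
      _ ≤ _ := mul_le_mul_right (add_le_add h1 h2) _

lemma measurableSet_hit {I : Set ENNReal} (hI : MeasurableSet I) (a : E) (x : ℕ → E) (N : ℕ) :
    MeasurableSet {t | (fun j => rademacher j t) ∈ hitSet I a x N} := by
  have : {t | (fun j => rademacher j t) ∈ hitSet I a x N}
      = ⋃ k ∈ Set.Iic N, (fun t => ‖a + radPartialSum x t k‖ₑ) ⁻¹' I := by
    ext t; simp [hitSet, radPartialSum_eq_signSum]
  rw [this]
  exact MeasurableSet.biUnion (Set.to_countable _) fun k _ =>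
    (stronglyMeasurable_const.add (stronglyMeasurable_radPartialSum x k)).enorm hI

lemma lintegral_indicator_hitSet {I : Set ENNReal} (hI : MeasurableSet I) (a : E) (x : ℕ → E)
    (N : ℕ) :
    ∫⁻ t, (hitSet I a x N).indicator 1 (fun j => rademacher j t) ∂unitMeasure
      = unitMeasure {t | (fun j => rademacher j t) ∈ hitSet I a x N} := by
  rw [← lintegral_indicator_one (measurableSet_hit hI a x N)]
  rfl

lemma radPartialSum_seqTail_of_le {M k : ℕ} (h : k ≤ M) (x : ℕ → E) (t : ℝ) :
    radPartialSum (seqTail M x) t k = 0 :=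
  Finset.sum_eq_zero fun j hj => by
    rw [seqTail_of_lt ((Finset.mem_range.1 hj).trans_le h), smul_zero]

lemma radPartialSum_seqTail_of_ge {M k : ℕ} (h : M ≤ k) (x : ℕ → E) (t : ℝ) :
    radPartialSum (seqTail M x) t k = radPartialSum x t k - radPartialSum x t M := by
  induction k, h using Nat.le_induction with
  | base => rw [radPartialSum_seqTail_of_le le_rfl, sub_self]
  | succ k hk ih =>
    unfold radPartialSum at ih ⊢
    rw [Finset.sum_range_succ, ih, seqTail_of_ge hk, Finset.sum_range_succ]
    abel

/-! ### Almost sure convergence and vanishing tails -/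

/-- `sup_N ‖∑_{j < N} r_j x_j‖` in `L²([0,1]; E)`: the extended norm that underlies both
`Rad` and `RAD`. -/
noncomputable def radNormSup (x : ℕ → E) : ENNReal := ⨆ N, radNormUpTo N x

lemma radNormUpTo_le_radNormSup (N : ℕ) (x : ℕ → E) : radNormUpTo N x ≤ radNormSup x :=
  le_iSup (fun N => radNormUpTo N x) N

/-- The tails of `x` tend to `0` for `radNormSup`. -/
def RadTailsVanish (x : ℕ → E) : Prop :=
  ∀ η : ENNReal, η ≠ 0 → ∃ M, radNormSup (seqTail M x) ≤ η

/-- A small probability of leaving the ball of radius `η` controls the second moment. The step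
that absorbs the second moment into the left-hand side uses that it is finite. -/
lemma radNormUpTo_le_of_measure_hitSet_le (η : ENNReal) (x : ℕ → E) (N : ℕ)
    (h : unitMeasure {t | (fun j => rademacher j t) ∈ hitSet (Set.Ioi η) 0 x N} ≤ 4⁻¹) :
    radNormUpTo N x ≤ 2 * η := by
  have hsub := lintegral_sub_sq_le η (radNormUpTo N x ^ 2) 0 (by simp) x N le_rfl
  rw [lintegral_indicator_hitSet measurableSet_Ioi] at hsub
  simp only [zero_add] at hsub
  set Q := radNormUpTo N x ^ 2 with hQ
  have hQtop : Q ≠ ⊤ := ENNReal.pow_ne_top (radNormUpTo_lt_top N x).ne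
  have hpt : ∀ f : ENNReal, f ^ 2 ≤ 2 * η ^ 2 + 2 * (f - η) ^ 2 := by
    intro f
    calc f ^ 2 ≤ (η + (f - η)) ^ 2 := by gcongr; exact le_add_tsub
      _ ≤ 2 * (η ^ 2 + (f - η) ^ 2) := by
        have h := ENNReal.rpow_add_le_mul_rpow_add_rpow η (f - η) (p := 2) (by norm_num)
        rw [show (2 : ℝ) - 1 = 1 by norm_num] at h
        simpa only [ENNReal.rpow_two, ENNReal.rpow_one] using h
      _ = _ := mul_add _ _ _
  have hQle : Q ≤ 2 * η ^ 2 + 2⁻¹ * Q := by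
    calc Q = ∫⁻ t, ‖radPartialSum x t N‖ₑ ^ 2 ∂unitMeasure := radNormUpTo_sq N x
      _ ≤ ∫⁻ t, (2 * η ^ 2 + 2 * (‖radPartialSum x t N‖ₑ - η) ^ 2) ∂unitMeasure :=
        lintegral_mono fun t => hpt _
      _ = 2 * η ^ 2 + 2 * ∫⁻ t, (‖radPartialSum x t N‖ₑ - η) ^ 2 ∂unitMeasure := by
        rw [lintegral_add_left measurable_const, lintegral_const, measure_univ, mul_one,
          lintegral_const_mul' _ _ (by simp)]
      _ ≤ 2 * η ^ 2 + 2 * (Q * 4⁻¹) := by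
        gcongr
        exact hsub.trans (by gcongr)
      _ = _ := by
        rw [show (4 : ENNReal) = 2 * 2 by norm_num, ENNReal.mul_inv (by simp) (by simp),
          mul_comm Q, ← mul_assoc, ← mul_assoc, ENNReal.mul_inv_cancel (by simp) (by simp),
          one_mul]
  have hhalf : 2⁻¹ * Q ≤ 2 * η ^ 2 := by
    have h2 : Q = 2⁻¹ * Q + 2⁻¹ * Q := by
      rw [← add_mul, ENNReal.inv_two_add_inv_two, one_mul]
    have hne : 2⁻¹ * Q ≠ ⊤ := ENNReal.mul_ne_top (by simp) hQtop
    exact (ENNReal.add_le_add_iff_right hne).1 (h2.symm.trans_le hQle)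
  refine (ENNReal.pow_le_pow_left_iff (n := 2) (by norm_num)).1 ?_
  calc Q = 2 * (2⁻¹ * Q) := by
        rw [← mul_assoc, ENNReal.mul_inv_cancel (by simp) (by simp), one_mul]
    _ ≤ 2 * (2 * η ^ 2) := by gcongr
    _ = (2 * η) ^ 2 := by ring

/-- Almost sure convergence makes the tails small in probability, hence in `L²`. -/
lemma AlmostUncondSummable.radTailsVanish {x : ℕ → E} (hx : AlmostUncondSummable x) :
    RadTailsVanish x := by
  intro η hη
  set δ := η / 2 with hδ
  have hδ0 : δ ≠ 0 := by simp [hδ, hη]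
  -- `C M` is the event that the partial sums of index at least `M` oscillate by more than `δ`.
  set C : ℕ → Set ℝ := fun M =>
    ⋃ k ∈ Set.Ici M, ⋃ l ∈ Set.Ici M,
      (fun t => ‖radPartialSum x t k - radPartialSum x t l‖ₑ) ⁻¹' Set.Ioi δ with hC
  have hCm : ∀ M, MeasurableSet (C M) := fun M =>
    MeasurableSet.biUnion (Set.to_countable _) fun k _ =>
      MeasurableSet.biUnion (Set.to_countable _) fun l _ =>
        ((stronglyMeasurable_radPartialSum x k).sub
          (stronglyMeasurable_radPartialSum x l)).enorm measurableSet_Ioi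
  have hanti : Antitone C := by
    intro M M' hM t ht
    simp only [hC, Set.mem_iUnion] at ht ⊢
    obtain ⟨k, hk, l, hl, h⟩ := ht
    exact ⟨k, le_trans hM hk, l, le_trans hM hl, h⟩
  have hnull : unitMeasure (⋂ M, C M) = 0 := by
    rw [measure_eq_zero_iff_ae_notMem]
    have hx' : ∀ᵐ t ∂unitMeasure, ∃ s : E, Tendsto (radPartialSum x t) atTop (𝓝 s) := hx
    filter_upwards [hx'] with t ht
    obtain ⟨s, hs⟩ := ht
    obtain ⟨M, hM⟩ := EMetric.cauchySeq_iff.1 hs.cauchySeq δ (pos_iff_ne_zero.2 hδ0)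
    intro hmem
    have := Set.mem_iInter.1 hmem M
    simp only [hC, Set.mem_iUnion] at this
    obtain ⟨k, hk, l, hl, h⟩ := this
    have h' := hM k hk l hl
    rw [edist_eq_enorm_sub] at h'
    exact lt_asymm h h'
  have hlim := tendsto_measure_iInter_atTop (μ := unitMeasure)
    (fun M => (hCm M).nullMeasurableSet) hanti ⟨0, measure_ne_top _ _⟩
  rw [hnull] at hlim
  obtain ⟨M, hM⟩ := (hlim.eventually_le_const (u := 4⁻¹) (by simp)).exists
  refine ⟨M, iSup_le fun N => ?_⟩
  have h2 : η = 2 * δ := by rw [hδ, ENNReal.mul_div_cancel (by simp) (by simp)]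
  rw [h2]
  refine radNormUpTo_le_of_measure_hitSet_le δ _ N ((measure_mono ?_).trans hM)
  rintro t ⟨k, -, hk⟩
  rw [zero_add, ← radPartialSum_eq_signSum] at hk
  rcases le_total k M with hkM | hkM
  · rw [radPartialSum_seqTail_of_le hkM] at hk
    simp at hk
  · rw [radPartialSum_seqTail_of_ge hkM] at hk
    simp only [hC, Set.mem_iUnion]
    exact ⟨k, hkM, M, Set.mem_Ici.2 le_rfl, hk⟩

/-- The converse: by the maximal inequality, `L²` convergence implies almost sure convergence. -/
lemma RadTailsVanish.almostUncondSummable [CompleteSpace E] {x : ℕ → E}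
    (hx : RadTailsVanish x) : AlmostUncondSummable x := by
  have hit : ∀ (η : ENNReal) (M : ℕ),
      η * unitMeasure {t | ∃ k, η ≤ ‖radPartialSum (seqTail M x) t k‖ₑ}
        ≤ radNormSup (seqTail M x) := by
    intro η M
    set D : ℕ → Set ℝ := fun N =>
      {t | (fun j => rademacher j t) ∈ hitSet (Set.Ici η) 0 (seqTail M x) N} with hD
    have hmono : Monotone D := fun N N' hN t ⟨k, hk, h⟩ => ⟨k, hk.trans hN, h⟩
    have hU : {t | ∃ k, η ≤ ‖radPartialSum (seqTail M x) t k‖ₑ} = ⋃ N, D N := by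
      ext t
      simp only [Set.mem_ofPred_eq, Set.mem_iUnion, hD, hitSet, zero_add, Set.mem_Ici,
        radPartialSum_eq_signSum]
      exact ⟨fun ⟨k, hk⟩ => ⟨k, k, le_rfl, hk⟩, fun ⟨_, k, _, hk⟩ => ⟨k, hk⟩⟩
    rw [hU, hmono.measure_iUnion, ENNReal.mul_iSup]
    refine iSup_le fun N => ?_
    have h := mul_lintegral_hitSet_le η 0 (seqTail M x) N
    rw [lintegral_indicator_hitSet measurableSet_Ici] at h
    simp only [zero_add] at h
    rw [← eLpNorm_one_eq_lintegral_enorm] at h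
    exact (h.trans (eLpNorm_le_eLpNorm_of_exponent_le (by norm_num)
      (aestronglyMeasurable_radPartialSum _ N))).trans (radNormUpTo_le_radNormSup N _)
  have hae : ∀ n : ℕ, ∀ᵐ t ∂unitMeasure,
      ∃ M, ∀ k, ‖radPartialSum (seqTail M x) t k‖ₑ < (n + 1 : ENNReal)⁻¹ := by
    intro n
    set η : ENNReal := (n + 1 : ENNReal)⁻¹ with hη
    have hη0 : η ≠ 0 := by simp [hη]
    have hbad : unitMeasure (⋂ M, {t | ∃ k, η ≤ ‖radPartialSum (seqTail M x) t k‖ₑ}) = 0 := by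
      have : ∀ δ : ENNReal, δ ≠ 0 →
          η * unitMeasure (⋂ M, {t | ∃ k, η ≤ ‖radPartialSum (seqTail M x) t k‖ₑ}) ≤ δ := by
        intro δ hδ
        obtain ⟨M, hM⟩ := hx δ hδ
        refine le_trans ?_ ((hit η M).trans hM)
        gcongr
        exact Set.iInter_subset _ M
      have h0 : η * unitMeasure (⋂ M, {t | ∃ k, η ≤ ‖radPartialSum (seqTail M x) t k‖ₑ}) = 0 := by
        by_contra hne
        have h1 := this _ (ENNReal.half_pos hne).ne'
        exact absurd (ENNReal.half_lt_self hne (ENNReal.mul_ne_top (by simp [hη])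
          (measure_ne_top _ _))) (not_lt.2 h1)
      exact (mul_eq_zero.1 h0).resolve_left hη0
    rw [measure_eq_zero_iff_ae_notMem] at hbad
    filter_upwards [hbad] with t ht
    simpa using ht
  have hae' := ae_all_iff.2 hae
  change ∀ᵐ t ∂unitMeasure, _
  filter_upwards [hae'] with t ht
  refine cauchySeq_tendsto_of_complete (EMetric.cauchySeq_iff'.2 fun ε hε => ?_)
  obtain ⟨n, hn⟩ := ENNReal.exists_inv_nat_lt hε.ne'
  obtain ⟨M, hM⟩ := ht n
  refine ⟨M, fun k hk => ?_⟩
  rw [edist_eq_enorm_sub, ← radPartialSum_seqTail_of_ge hk]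
  refine (hM k).trans (lt_of_le_of_lt ?_ hn)
  gcongr
  exact le_self_add

lemma AlmostUncondSummable.ae_tendsto_radSum {x : ℕ → E} (hx : AlmostUncondSummable x) :
    ∀ᵐ t ∂unitMeasure, Tendsto (radPartialSum x t) atTop (𝓝 (radSum x t)) := by
  have hx' : ∀ᵐ t ∂unitMeasure, ∃ s : E, Tendsto (radPartialSum x t) atTop (𝓝 s) := hx
  filter_upwards [hx'] with t ht
  exact tendsto_nhds_limUnder ht

lemma AlmostUncondSummable.aestronglyMeasurable_radSum {x : ℕ → E}
    (hx : AlmostUncondSummable x) : AEStronglyMeasurable (radSum x) unitMeasure :=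
  aestronglyMeasurable_of_tendsto_ae atTop (aestronglyMeasurable_radPartialSum x)
    hx.ae_tendsto_radSum

/-- Fatou's lemma bounds the norm of the sum; applied to the tails, it also bounds the distance
from the sum to its partial sums. -/
lemma AlmostUncondSummable.eLpNorm_radSum {x : ℕ → E} (hx : AlmostUncondSummable x) :
    eLpNorm (radSum x) 2 unitMeasure = radNormSup x := by
  apply le_antisymm
  · have h := Lp.eLpNorm_lim_le_liminf_eLpNorm (p := 2) (aestronglyMeasurable_radPartialSum x)
      (radSum x) hx.ae_tendsto_radSum
    exact h.trans_eq (tendsto_atTop_iSup (radNormUpTo_mono x)).liminf_eq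
  · refine iSup_le fun N => ENNReal.le_of_forall_pos_le_add fun η hη _ => ?_
    obtain ⟨M, hM⟩ := hx.radTailsVanish η (by simpa using hη.ne')
    set K := max N M
    have hdiff : eLpNorm (radSum x - fun t => radPartialSum x t K) 2 unitMeasure ≤ η := by
      have h := Lp.eLpNorm_lim_le_liminf_eLpNorm (p := 2)
        (aestronglyMeasurable_radPartialSum (seqTail K x))
        (radSum x - fun t => radPartialSum x t K) (by
          filter_upwards [hx.ae_tendsto_radSum] with t ht
          refine (ht.sub_const (radPartialSum x t K)).congr' ?_
          filter_upwards [eventually_ge_atTop K] with k hk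
          exact (radPartialSum_seqTail_of_ge hk x t).symm)
      refine (h.trans_eq (tendsto_atTop_iSup (radNormUpTo_mono (seqTail K x))).liminf_eq).trans ?_
      refine le_trans (iSup_mono fun L => ?_) hM
      have : seqTail K x = (Set.Ici K).indicator (seqTail M x) := by
        rw [seqTail, seqTail, Set.indicator_indicator, Set.inter_eq_left.2]
        exact Set.Ici_subset_Ici.2 (le_max_right _ _)
      rw [this]
      exact radNormUpTo_indicator_le _ _ _
    calc radNormUpTo N x ≤ radNormUpTo K x := radNormUpTo_mono x (le_max_left _ _)
      _ = eLpNorm (radSum x - (radSum x - fun t => radPartialSum x t K)) 2 unitMeasure := by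
        rw [sub_sub_cancel]; rfl
      _ ≤ eLpNorm (radSum x) 2 unitMeasure
          + eLpNorm (radSum x - fun t => radPartialSum x t K) 2 unitMeasure :=
        eLpNorm_sub_le hx.aestronglyMeasurable_radSum (hx.aestronglyMeasurable_radSum.sub
          (aestronglyMeasurable_radPartialSum x K)) (by norm_num)
      _ ≤ _ := by gcongr

lemma AlmostUncondSummable.radNorm_eq {x : ℕ → E} (hx : AlmostUncondSummable x) :
    radNorm x = (radNormSup x).toReal := by
  have hsq : eLpNorm (radSum x) 2 unitMeasure ^ 2 = ∫⁻ t, ‖radSum x t‖ₑ ^ 2 ∂unitMeasure := by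
    simpa using eLpNorm_nnreal_pow_eq_lintegral (f := radSum x) (μ := unitMeasure) (p := 2)
      (by simp)
  have hm : AEStronglyMeasurable (fun t => ‖radSum x t‖ ^ 2) unitMeasure :=
    hx.aestronglyMeasurable_radSum.norm.pow 2
  rw [radNorm, integral_eq_lintegral_of_nonneg_ae (ae_of_all _ fun t => by positivity) hm]
  simp only [ENNReal.ofReal_pow (norm_nonneg _), ofReal_norm]
  rw [← hsq, hx.eLpNorm_radSum, ENNReal.toReal_pow, Real.sqrt_sq ENNReal.toReal_nonneg]

end Convergence

/-! ### The supremum norm: closedness, completeness and multilinear bounds -/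

section SupNorm

variable {E : Type*} [NormedAddCommGroup E] [NormedSpace ℝ E]

lemma radNormSup_add_le (x y : ℕ → E) : radNormSup (x + y) ≤ radNormSup x + radNormSup y :=
  iSup_le fun N => (radNormUpTo_add_le N x y).trans
    (add_le_add (radNormUpTo_le_radNormSup N x) (radNormUpTo_le_radNormSup N y))

lemma radNormSup_smul {𝕜 : Type*} [RCLike 𝕜] [NormedSpace 𝕜 E] [SMulCommClass ℝ 𝕜 E]
    (c : 𝕜) (x : ℕ → E) : radNormSup (c • x) = ‖c‖ₑ * radNormSup x := by
  simp only [radNormSup, radNormUpTo_smul, ENNReal.mul_iSup]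

lemma enorm_le_radNormSup (x : ℕ → E) (j : ℕ) : ‖x j‖ₑ ≤ radNormSup x :=
  (enorm_le_radNormUpTo (Nat.lt_succ_self j) x).trans (radNormUpTo_le_radNormSup _ x)

lemma radNormSup_eq_radNormUpTo {N : ℕ} {x : ℕ → E} (hx : ∀ j, N ≤ j → x j = 0) :
    radNormSup x = radNormUpTo N x := by
  refine le_antisymm (iSup_le fun M => ?_) (radNormUpTo_le_radNormSup N x)
  rcases le_total M N with h | h
  · exact radNormUpTo_mono x h
  · exact (radNormUpTo_of_forall_ge_eq_zero h hx).le

lemma radNormSup_single (j : ℕ) (v : E) : radNormSup (Pi.single j v) = ‖v‖ₑ := by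
  rw [radNormSup_eq_radNormUpTo (N := j + 1), radNormUpTo_single (Nat.lt_succ_self j)]
  intro i hi
  simp [show i ≠ j by lia]

lemma radNormSup_finiteSection (k : ℕ) (x : ℕ → E) :
    radNormSup (finiteSection k x) = radNormUpTo k x := by
  rw [radNormSup_eq_radNormUpTo (N := k) fun j hj => by simp [finiteSection, hj]]
  exact radNormUpTo_congr fun j hj => by simp [finiteSection, hj]

lemma radNormSup_seqTail_eq_zero {N : ℕ} {x : ℕ → E} (hx : ∀ j, N ≤ j → x j = 0) :
    radNormSup (seqTail N x) = 0 := by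
  have : seqTail N x = 0 := by
    ext j
    rcases lt_or_ge j N with h | h
    · exact seqTail_of_lt h x
    · exact (seqTail_of_ge h x).trans (hx j h)
  rw [this, radNormSup_eq_radNormUpTo (N := 0) (x := 0) (fun _ _ => rfl)]
  simpa using radNormUpTo_le_sum 0 (0 : ℕ → E)

lemma radTailsVanish_of_finite {x : ℕ → E} (hx : ∃ N, ∀ j ≥ N, x j = 0) : RadTailsVanish x := by
  obtain ⟨N, hN⟩ := hx
  exact fun η _ => ⟨N, (radNormSup_seqTail_eq_zero hN).trans_le (zero_le)⟩

lemma RadTailsVanish.radNormSup_lt_top {x : ℕ → E} (hx : RadTailsVanish x) :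
    radNormSup x < ⊤ := by
  obtain ⟨M, hM⟩ := hx 1 one_ne_zero
  have hsplit : x = finiteSection M x + seqTail M x := by
    ext j
    rcases lt_or_ge j M with h | h
    · simp [finiteSection, h]
    · simp [finiteSection, h]
  calc radNormSup x ≤ radNormSup (finiteSection M x) + radNormSup (seqTail M x) := by
        conv_lhs => rw [hsplit]
        exact radNormSup_add_le _ _
    _ ≤ radNormUpTo M x + 1 := by
        rw [radNormSup_finiteSection]
        gcongr
    _ < ⊤ := ENNReal.add_lt_top.2 ⟨radNormUpTo_lt_top M x, ENNReal.one_lt_top⟩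

lemma radNormSup_indicator_le (x : ℕ → E) (s : Set ℕ) :
    radNormSup (s.indicator x) ≤ radNormSup x :=
  iSup_mono fun N => radNormUpTo_indicator_le N x s

lemma radNormSup_neg (x : ℕ → E) : radNormSup (-x) = radNormSup x := by
  have h := radNormSup_smul (-1 : ℝ) x
  simpa using h

lemma RadTailsVanish.of_approx {x : ℕ → E}
    (h : ∀ η : ENNReal, η ≠ 0 → ∃ y, RadTailsVanish y ∧ radNormSup (y - x) ≤ η) :
    RadTailsVanish x := by
  intro η hη
  obtain ⟨y, hy, hyx⟩ := h (η / 2) (ENNReal.half_pos hη).ne'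
  obtain ⟨M, hM⟩ := hy (η / 2) (ENNReal.half_pos hη).ne'
  refine ⟨M, ?_⟩
  have hsplit : seqTail M x = seqTail M y + -seqTail M (y - x) := by
    rw [seqTail, seqTail, seqTail, Set.indicator_sub']
    abel
  calc radNormSup (seqTail M x) ≤ radNormSup (seqTail M y) + radNormSup (seqTail M (y - x)) := by
        rw [hsplit, ← radNormSup_neg (seqTail M (y - x))]
        exact radNormSup_add_le _ _
    _ ≤ η / 2 + η / 2 := add_le_add hM ((radNormSup_indicator_le _ _).trans hyx)
    _ = η := ENNReal.add_halves η

/-- Completeness: the limit is taken coordinatewise. -/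
lemma exists_radNormSup_limit [CompleteSpace E] (s : ℕ → ℕ → E)
    (hs : ∀ ε : ENNReal, ε ≠ 0 → ∃ N, ∀ i ≥ N, ∀ k ≥ N, radNormSup (s i - s k) ≤ ε) :
    ∃ x : ℕ → E, ∀ ε : ENNReal, ε ≠ 0 → ∃ N, ∀ i ≥ N, radNormSup (s i - x) ≤ ε := by
  have hcoord : ∀ j, ∃ v, Tendsto (fun i => s i j) atTop (𝓝 v) := by
    intro j
    refine cauchySeq_tendsto_of_complete (EMetric.cauchySeq_iff.2 fun ε hε => ?_)
    obtain ⟨δ, hδ0, hδ⟩ := exists_between hε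
    obtain ⟨N, hN⟩ := hs δ hδ0.ne'
    refine ⟨N, fun i hi k hk => ?_⟩
    rw [edist_eq_enorm_sub]
    exact ((enorm_le_radNormSup (s i - s k) j).trans (hN i hi k hk)).trans_lt hδ
  choose x hx using hcoord
  refine ⟨x, fun ε hε => ?_⟩
  obtain ⟨N, hN⟩ := hs ε hε
  refine ⟨N, fun i hi => iSup_le fun L => ?_⟩
  have hlim : Tendsto (fun k => ε + ∑ j ∈ Finset.range L, ‖s k j - x j‖ₑ) atTop (𝓝 ε) := by
    have h0 : Tendsto (fun k => ∑ j ∈ Finset.range L, ‖s k j - x j‖ₑ) atTop (𝓝 0) := by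
      have := tendsto_finsetSum (Finset.range L) fun j _ =>
        (tendsto_iff_edist_tendsto_0.1 (hx j))
      simpa [edist_eq_enorm_sub] using this
    simpa using h0.const_add ε
  refine ge_of_tendsto hlim ?_
  filter_upwards [eventually_ge_atTop N] with k hk
  calc radNormUpTo L (s i - x) = radNormUpTo L ((s i - s k) + (s k - x)) := by
        rw [sub_add_sub_cancel]
    _ ≤ radNormUpTo L (s i - s k) + radNormUpTo L (s k - x) := radNormUpTo_add_le _ _ _
    _ ≤ _ := add_le_add ((radNormUpTo_le_radNormSup L _).trans (hN i hi k hk))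
        (radNormUpTo_le_sum L _)

end SupNorm

section Multilinear

variable {n : ℕ} {E : Fin (n + 1) → Type u} {F : Type u}
  [∀ m, NormedAddCommGroup (E m)] [∀ m, NormedSpace ℝ (E m)]
  [NormedAddCommGroup F] [NormedSpace ℝ F]

lemma radNormSup_multilinear_le (A : ContinuousMultilinearMap ℝ E F) (x : ∀ m, ℕ → E m) :
    radNormSup (fun j => A fun m => x m j) ≤ ‖A‖ₑ * ∏ m, radNormSup (x m) :=
  iSup_le fun N => (radNormUpTo_multilinear_le A x N).trans (by
    gcongr with m
    exact radNormUpTo_le_radNormSup N (x m))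

/-- The image under `A` of the `M`-th tails is the `M`-th tail of the image, so one vanishing
tail and boundedness of the other factors suffice. -/
lemma radTailsVanish_multilinear (A : ContinuousMultilinearMap ℝ E F) (x : ∀ m, ℕ → E m)
    (hx : ∀ m, RadTailsVanish (x m)) : RadTailsVanish (fun j => A fun m => x m j) := by
  have htail : ∀ M, seqTail M (fun j => A fun m => x m j)
      = fun j => A fun m => seqTail M (x m) j := by
    intro M
    ext j
    rcases lt_or_ge j M with h | h
    · rw [seqTail_of_lt h]
      exact (A.map_coord_zero 0 (seqTail_of_lt h _)).symm
    · rw [seqTail_of_ge h]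
      congr 1; ext m
      exact (seqTail_of_ge h _).symm
  set C : ENNReal := ‖A‖ₑ * ∏ m : Fin n, radNormSup (x m.succ) with hC
  have hCtop : C ≠ ⊤ := ENNReal.mul_ne_top (enorm_ne_top)
    (ENNReal.prod_ne_top fun m _ => (hx m.succ).radNormSup_lt_top.ne)
  intro η hη
  obtain ⟨M, hM⟩ := hx 0 (η / C) (ENNReal.div_pos hη hCtop).ne'
  refine ⟨M, ?_⟩
  rw [htail]
  calc _ ≤ ‖A‖ₑ * ∏ m, radNormSup (seqTail M (x m)) := radNormSup_multilinear_le A _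
    _ ≤ ‖A‖ₑ * (η / C * ∏ m : Fin n, radNormSup (x m.succ)) := by
        rw [Fin.prod_univ_succ]
        gcongr with m
        exact radNormSup_indicator_le _ _
    _ = C * (η / C) := by rw [hC]; ring
    _ ≤ η := ENNReal.mul_div_le

end Multilinear

/-! ### Real and complex scalars -/

section Scalars

variable (𝕜 : Type) [RCLike 𝕜] {E : Type u} [NormedAddCommGroup E] [NormedSpace 𝕜 E]

/-- `radNormSup` on a space over `𝕜`, formed with the underlying real structure
as in the definition of `Rad`. -/
noncomputable def extRadNorm (x : ℕ → E) : ENNReal :=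
  letI : NormedSpace ℝ E := NormedSpace.restrictScalars ℝ 𝕜 E
  radNormSup x

/-- `RadTailsVanish` on a space over `𝕜`. -/
def ExtRadTailsVanish (x : ℕ → E) : Prop :=
  letI : NormedSpace ℝ E := NormedSpace.restrictScalars ℝ 𝕜 E
  RadTailsVanish x

lemma extRadNorm_add_le (x y : ℕ → E) :
    extRadNorm 𝕜 (x + y) ≤ extRadNorm 𝕜 x + extRadNorm 𝕜 y :=
  letI : NormedSpace ℝ E := NormedSpace.restrictScalars ℝ 𝕜 E
  radNormSup_add_le x y

lemma extRadNorm_smul (c : 𝕜) (x : ℕ → E) : extRadNorm 𝕜 (c • x) = ‖c‖ₑ * extRadNorm 𝕜 x := by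
  let : NormedSpace ℝ E := NormedSpace.restrictScalars ℝ 𝕜 E
  have : IsScalarTower ℝ 𝕜 E := IsScalarTower.of_algebraMap_smul fun _ _ => rfl
  exact radNormSup_smul c x

lemma enorm_le_extRadNorm (x : ℕ → E) (j : ℕ) : ‖x j‖ₑ ≤ extRadNorm 𝕜 x :=
  letI : NormedSpace ℝ E := NormedSpace.restrictScalars ℝ 𝕜 E
  enorm_le_radNormSup x j

lemma extRadNorm_single (j : ℕ) (v : E) : extRadNorm 𝕜 (Pi.single j v) = ‖v‖ₑ :=
  letI : NormedSpace ℝ E := NormedSpace.restrictScalars ℝ 𝕜 E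
  radNormSup_single j v

lemma exists_extRadNorm_limit [CompleteSpace E] (s : ℕ → ℕ → E)
    (hs : ∀ ε : ENNReal, ε ≠ 0 → ∃ N, ∀ i ≥ N, ∀ k ≥ N, extRadNorm 𝕜 (s i - s k) ≤ ε) :
    ∃ x : ℕ → E, ∀ ε : ENNReal, ε ≠ 0 → ∃ N, ∀ i ≥ N, extRadNorm 𝕜 (s i - x) ≤ ε :=
  letI : NormedSpace ℝ E := NormedSpace.restrictScalars ℝ 𝕜 E
  exists_radNormSup_limit s hs

lemma mem_carrier_Rad_iff [CompleteSpace E] {x : ℕ → E} :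
    x ∈ (Rad.{u} 𝕜).carrier E ↔ ExtRadTailsVanish 𝕜 x :=
  letI : NormedSpace ℝ E := NormedSpace.restrictScalars ℝ 𝕜 E
  ⟨AlmostUncondSummable.radTailsVanish, RadTailsVanish.almostUncondSummable⟩

lemma ExtRadTailsVanish.extRadNorm_lt_top {x : ℕ → E} (hx : ExtRadTailsVanish 𝕜 x) :
    extRadNorm 𝕜 x < ⊤ :=
  letI : NormedSpace ℝ E := NormedSpace.restrictScalars ℝ 𝕜 E
  RadTailsVanish.radNormSup_lt_top hx

lemma norm_Rad_eq [CompleteSpace E] {x : ℕ → E} (hx : x ∈ (Rad.{u} 𝕜).carrier E) :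
    (Rad.{u} 𝕜).norm E x = (extRadNorm 𝕜 x).toReal :=
  letI : NormedSpace ℝ E := NormedSpace.restrictScalars ℝ 𝕜 E
  AlmostUncondSummable.radNorm_eq hx

lemma mem_carrier_Rad_of_finite [CompleteSpace E] {x : ℕ → E} (hx : ∃ N, ∀ j ≥ N, x j = 0) :
    x ∈ (Rad.{u} 𝕜).carrier E :=
  letI : NormedSpace ℝ E := NormedSpace.restrictScalars ℝ 𝕜 E
  (mem_carrier_Rad_iff 𝕜).2 (radTailsVanish_of_finite hx)

lemma norm_Rad_finiteSection [CompleteSpace E] (k : ℕ) (x : ℕ → E) :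
    letI : NormedSpace ℝ E := NormedSpace.restrictScalars ℝ 𝕜 E
    (Rad.{u} 𝕜).norm E (finiteSection k x) = (radNormUpTo k x).toReal := by
  let : NormedSpace ℝ E := NormedSpace.restrictScalars ℝ 𝕜 E
  rw [norm_Rad_eq 𝕜 (mem_carrier_Rad_of_finite 𝕜 ⟨k, fun j hj => by
    simp [finiteSection, not_lt.2 hj]⟩), ← radNormSup_finiteSection]
  rfl

lemma mem_carrier_RAD_iff [CompleteSpace E] {x : ℕ → E} :
    x ∈ (RAD.{u} 𝕜).carrier E ↔ extRadNorm 𝕜 x < ⊤ := by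
  let : NormedSpace ℝ E := NormedSpace.restrictScalars ℝ 𝕜 E
  change BddAbove (Set.range fun k : ℕ => (Rad.{u} 𝕜).norm E (finiteSection k x))
    ↔ radNormSup x < ⊤
  simp only [norm_Rad_finiteSection]
  constructor
  · rintro ⟨C, hC⟩
    refine lt_of_le_of_lt (iSup_le fun N => ?_) (ENNReal.ofReal_lt_top (r := C))
    exact ENNReal.le_ofReal_iff_toReal_le (radNormUpTo_lt_top N x).ne
      (ENNReal.toReal_nonneg.trans (hC ⟨0, rfl⟩)) |>.2 (hC ⟨N, rfl⟩)
  · intro h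
    refine ⟨(radNormSup x).toReal, ?_⟩
    rintro _ ⟨N, rfl⟩
    exact ENNReal.toReal_mono h.ne (radNormUpTo_le_radNormSup N x)

lemma norm_RAD_eq [CompleteSpace E] (x : ℕ → E) :
    (RAD.{u} 𝕜).norm E x = (extRadNorm 𝕜 x).toReal := by
  let : NormedSpace ℝ E := NormedSpace.restrictScalars ℝ 𝕜 E
  change ⨆ k : ℕ, (Rad.{u} 𝕜).norm E (finiteSection k x) = (⨆ N, radNormUpTo N x).toReal
  simp only [norm_Rad_finiteSection]
  exact (ENNReal.toReal_iSup fun N => (radNormUpTo_lt_top N x).ne).symm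

variable {𝕜}

lemma extRadNorm_inducedSeq_le {n : ℕ} (hn : 1 ≤ n) {E : Fin n → Type u} {F : Type u}
    [∀ m, NormedAddCommGroup (E m)] [∀ m, NormedSpace 𝕜 (E m)]
    [NormedAddCommGroup F] [NormedSpace 𝕜 F]
    (A : ContinuousMultilinearMap 𝕜 E F) (x : ∀ m, ℕ → E m) :
    extRadNorm 𝕜 (inducedSeq A x) ≤ ‖A‖ₑ * ∏ m, extRadNorm 𝕜 (x m) := by
  obtain ⟨n, rfl⟩ : ∃ k, n = k + 1 := ⟨n - 1, by lia⟩
  let : ∀ m, NormedSpace ℝ (E m) := fun m => NormedSpace.restrictScalars ℝ 𝕜 (E m)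
  let : NormedSpace ℝ F := NormedSpace.restrictScalars ℝ 𝕜 F
  have : ∀ m, IsScalarTower ℝ 𝕜 (E m) := fun m =>
    IsScalarTower.of_algebraMap_smul fun _ _ => rfl
  have : IsScalarTower ℝ 𝕜 F := IsScalarTower.of_algebraMap_smul fun _ _ => rfl
  have h := radNormSup_multilinear_le (A.restrictScalars ℝ) x
  rwa [← enorm_norm, ContinuousMultilinearMap.norm_restrictScalars, enorm_norm] at h

lemma extRadTailsVanish_inducedSeq {n : ℕ} (hn : 1 ≤ n) {E : Fin n → Type u} {F : Type u}
    [∀ m, NormedAddCommGroup (E m)] [∀ m, NormedSpace 𝕜 (E m)]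
    [NormedAddCommGroup F] [NormedSpace 𝕜 F]
    (A : ContinuousMultilinearMap 𝕜 E F) (x : ∀ m, ℕ → E m)
    (hx : ∀ m, ExtRadTailsVanish 𝕜 (x m)) : ExtRadTailsVanish 𝕜 (inducedSeq A x) := by
  obtain ⟨n, rfl⟩ : ∃ k, n = k + 1 := ⟨n - 1, by lia⟩
  let : ∀ m, NormedSpace ℝ (E m) := fun m => NormedSpace.restrictScalars ℝ 𝕜 (E m)
  let : NormedSpace ℝ F := NormedSpace.restrictScalars ℝ 𝕜 F
  have : ∀ m, IsScalarTower ℝ 𝕜 (E m) := fun m =>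
    IsScalarTower.of_algebraMap_smul fun _ _ => rfl
  have : IsScalarTower ℝ 𝕜 F := IsScalarTower.of_algebraMap_smul fun _ _ => rfl
  exact radTailsVanish_multilinear (A.restrictScalars ℝ) x hx

/-! ### Sequence classes with the Rademacher norm -/

/-- A rule whose norm is `extRadNorm` and whose carriers are closed subspaces, for that norm, of
the space of sequences where it is finite, stable under the induced maps. Both `Rad` and `RAD`
are of this kind. -/
structure IsRademacherRule (X : SequenceRule.{u} 𝕜) : Prop where
  lt_top : ∀ (E : Type u) [NormedAddCommGroup E] [NormedSpace 𝕜 E] [CompleteSpace E],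
    ∀ x ∈ X.carrier E, extRadNorm 𝕜 x < ⊤
  norm_eq : ∀ (E : Type u) [NormedAddCommGroup E] [NormedSpace 𝕜 E] [CompleteSpace E],
    ∀ x ∈ X.carrier E, X.norm E x = (extRadNorm 𝕜 x).toReal
  add_mem : ∀ (E : Type u) [NormedAddCommGroup E] [NormedSpace 𝕜 E] [CompleteSpace E],
    ∀ x ∈ X.carrier E, ∀ y ∈ X.carrier E, x + y ∈ X.carrier E
  smul_mem : ∀ (E : Type u) [NormedAddCommGroup E] [NormedSpace 𝕜 E] [CompleteSpace E],
    ∀ (c : 𝕜), ∀ x ∈ X.carrier E, c • x ∈ X.carrier E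
  finite_mem : ∀ (E : Type u) [NormedAddCommGroup E] [NormedSpace 𝕜 E] [CompleteSpace E],
    ∀ x : ℕ → E, (∃ N, ∀ j ≥ N, x j = 0) → x ∈ X.carrier E
  closed : ∀ (E : Type u) [NormedAddCommGroup E] [NormedSpace 𝕜 E] [CompleteSpace E],
    ∀ x : ℕ → E, (∀ η : ENNReal, η ≠ 0 → ∃ y ∈ X.carrier E, extRadNorm 𝕜 (y - x) ≤ η) →
      x ∈ X.carrier E
  induced_mem : ∀ (n : ℕ), 1 ≤ n → ∀ (E : Fin n → Type u) (F : Type u)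
    [∀ m, NormedAddCommGroup (E m)] [∀ m, NormedSpace 𝕜 (E m)] [∀ m, CompleteSpace (E m)]
    [NormedAddCommGroup F] [NormedSpace 𝕜 F] [CompleteSpace F]
    (A : ContinuousMultilinearMap 𝕜 E F) (x : ∀ m, ℕ → E m),
    (∀ m, x m ∈ X.carrier (E m)) → inducedSeq A x ∈ X.carrier F

namespace IsRademacherRule

variable {X : SequenceRule.{u} 𝕜}

lemma sub_mem (h : IsRademacherRule X) [CompleteSpace E] {x y : ℕ → E} (hx : x ∈ X.carrier E)
    (hy : y ∈ X.carrier E) : x - y ∈ X.carrier E := by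
  have := h.add_mem E x hx _ (h.smul_mem E (-1) y hy)
  rwa [neg_one_smul, ← sub_eq_add_neg] at this

lemma single_mem (h : IsRademacherRule X) [CompleteSpace E] (j : ℕ) (v : E) :
    Pi.single j v ∈ X.carrier E :=
  h.finite_mem E _ ⟨j + 1, fun i hi => by simp [show i ≠ j by lia]⟩

lemma norm_single_eq (h : IsRademacherRule X) [CompleteSpace E] (j : ℕ) (v : E) :
    X.norm E (Pi.single j v) = ‖v‖ := by
  rw [h.norm_eq E _ (h.single_mem j v), extRadNorm_single, toReal_enorm]

lemma isSequenceClass (h : IsRademacherRule X) : IsSequenceClass X where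
  add_mem := h.add_mem
  smul_mem := h.smul_mem
  norm_add_le E _ _ _ x hx y hy := by
    rw [h.norm_eq E _ (h.add_mem E x hx y hy), h.norm_eq E x hx, h.norm_eq E y hy,
      ← ENNReal.toReal_add (h.lt_top E x hx).ne (h.lt_top E y hy).ne]
    exact ENNReal.toReal_mono
      (ENNReal.add_ne_top.2 ⟨(h.lt_top E x hx).ne, (h.lt_top E y hy).ne⟩)
      (extRadNorm_add_le 𝕜 x y)
  norm_smul E _ _ _ c x hx := by
    rw [h.norm_eq E _ (h.smul_mem E c x hx), h.norm_eq E x hx, extRadNorm_smul,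
      ENNReal.toReal_mul, toReal_enorm]
  eq_zero_of_norm E _ _ _ x hx hx0 := by
    rw [h.norm_eq E x hx, ENNReal.toReal_eq_zero_iff] at hx0
    have h0 := hx0.resolve_right (h.lt_top E x hx).ne
    ext j
    exact enorm_eq_zero.1 (le_antisymm ((enorm_le_extRadNorm 𝕜 x j).trans_eq h0) (zero_le))
  complete E _ _ _ s hs hcau := by
    have hcau' : ∀ ε : ENNReal, ε ≠ 0 →
        ∃ N, ∀ i ≥ N, ∀ k ≥ N, extRadNorm 𝕜 (s i - s k) ≤ ε := by
      intro ε hε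
      rcases eq_or_ne ε ⊤ with rfl | hεt
      · exact ⟨0, fun _ _ _ _ => le_top⟩
      · obtain ⟨N, hN⟩ := hcau ε.toReal (ENNReal.toReal_pos hε hεt)
        refine ⟨N, fun i hi k hk => ?_⟩
        have hm := h.sub_mem (hs i) (hs k)
        have h1 := hN i hi k hk
        rw [h.norm_eq E _ hm] at h1
        exact (ENNReal.toReal_le_toReal (h.lt_top E _ hm).ne hεt).1 h1.le
    obtain ⟨x, hx⟩ := exists_extRadNorm_limit 𝕜 s hcau'
    have hmem : x ∈ X.carrier E := h.closed E x fun η hη => by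
      obtain ⟨N, hN⟩ := hx η hη
      exact ⟨s N, hs N, hN N le_rfl⟩
    refine ⟨x, hmem, ?_⟩
    have hlim : Tendsto (fun i => extRadNorm 𝕜 (s i - x)) atTop (𝓝 0) := by
      refine ENNReal.tendsto_nhds_zero.2 fun ε hε => ?_
      obtain ⟨N, hN⟩ := hx ε hε.ne'
      exact eventually_atTop.2 ⟨N, hN⟩
    have := (ENNReal.tendsto_toReal ENNReal.zero_ne_top).comp hlim
    refine this.congr fun i => ?_
    exact (h.norm_eq E _ (h.sub_mem (hs i) hmem)).symm
  finite_mem := h.finite_mem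
  norm_coord_le E _ _ _ x hx j := by
    rw [h.norm_eq E x hx, ← toReal_enorm]
    exact ENNReal.toReal_mono (h.lt_top E x hx).ne (enorm_le_extRadNorm 𝕜 x j)
  norm_single j := by
    rw [h.norm_single_eq]
    simp

theorem multilinearlyStable (h : IsRademacherRule X) : MultilinearlyStable X := by
  refine ⟨h.isSequenceClass, fun n hn E F _ _ _ _ _ _ A =>
    ⟨h.induced_mem n hn E F A, ⟨norm_nonneg _, fun x hx => ?_⟩, fun C hC => ?_⟩⟩
  · rw [h.norm_eq F _ (h.induced_mem n hn E F A x hx)]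
    have hprod : ∏ m, X.norm (E m) (x m) = (∏ m, extRadNorm 𝕜 (x m)).toReal := by
      rw [ENNReal.toReal_prod]
      exact Finset.prod_congr rfl fun m _ => h.norm_eq (E m) (x m) (hx m)
    rw [hprod, ← toReal_enorm, ← ENNReal.toReal_mul]
    exact ENNReal.toReal_mono (ENNReal.mul_ne_top enorm_ne_top
      (ENNReal.prod_ne_top fun m _ => (h.lt_top (E m) (x m) (hx m)).ne))
      (extRadNorm_inducedSeq_le hn A x)
  · -- Test the bound on sequences supported at the first coordinate.
    refine A.opNorm_le_bound hC.1 fun v => ?_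
    have hind : inducedSeq A (fun m => Pi.single 0 (v m)) = Pi.single 0 (A v) := by
      ext j
      by_cases hj : j = 0
      · subst hj; simp [inducedSeq]
      · rw [Pi.single_eq_of_ne hj]
        exact A.map_coord_zero ⟨0, hn⟩ (Pi.single_eq_of_ne hj _)
    have hb := hC.2 (fun m => Pi.single 0 (v m)) fun m => h.single_mem 0 (v m)
    rw [hind, h.norm_single_eq] at hb
    simpa only [h.norm_single_eq] using hb

end IsRademacherRule

end Scalars

lemma isRademacherRule_Rad (𝕜 : Type) [RCLike 𝕜] : IsRademacherRule (Rad.{u} 𝕜) where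
  lt_top E _ _ _ x hx := ((mem_carrier_Rad_iff 𝕜).1 hx).extRadNorm_lt_top
  norm_eq E _ _ _ x hx := norm_Rad_eq 𝕜 hx
  add_mem E _ _ _ x hx y hy := by
    let : NormedSpace ℝ E := NormedSpace.restrictScalars ℝ 𝕜 E
    change ∀ᵐ t ∂unitMeasure, ∃ s : E, Tendsto (radPartialSum x t) atTop (𝓝 s) at hx
    change ∀ᵐ t ∂unitMeasure, ∃ s : E, Tendsto (radPartialSum y t) atTop (𝓝 s) at hy
    change ∀ᵐ t ∂unitMeasure, ∃ s : E, Tendsto (radPartialSum (x + y) t) atTop (𝓝 s)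
    filter_upwards [hx, hy] with t ⟨a, ha⟩ ⟨b, hb⟩
    exact ⟨a + b, (ha.add hb).congr fun N => (radPartialSum_add x y t N).symm⟩
  smul_mem E _ _ _ c x hx := by
    let : NormedSpace ℝ E := NormedSpace.restrictScalars ℝ 𝕜 E
    have : IsScalarTower ℝ 𝕜 E := IsScalarTower.of_algebraMap_smul fun _ _ => rfl
    change ∀ᵐ t ∂unitMeasure, ∃ s : E, Tendsto (radPartialSum x t) atTop (𝓝 s) at hx
    change ∀ᵐ t ∂unitMeasure, ∃ s : E, Tendsto (radPartialSum (c • x) t) atTop (𝓝 s)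
    filter_upwards [hx] with t ⟨a, ha⟩
    exact ⟨c • a, (ha.const_smul c).congr fun N => (radPartialSum_smul c x t N).symm⟩
  finite_mem E _ _ _ x hx := mem_carrier_Rad_of_finite 𝕜 hx
  closed E _ _ _ x hx := by
    let : NormedSpace ℝ E := NormedSpace.restrictScalars ℝ 𝕜 E
    refine (mem_carrier_Rad_iff 𝕜).2 (RadTailsVanish.of_approx fun η hη => ?_)
    obtain ⟨y, hy, hyx⟩ := hx η hη
    exact ⟨y, (mem_carrier_Rad_iff 𝕜).1 hy, hyx⟩
  induced_mem n hn E F _ _ _ _ _ _ A x hx :=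
    (mem_carrier_Rad_iff 𝕜).2 (extRadTailsVanish_inducedSeq hn A x
      fun m => (mem_carrier_Rad_iff 𝕜).1 (hx m))

lemma isRademacherRule_RAD (𝕜 : Type) [RCLike 𝕜] : IsRademacherRule (RAD.{u} 𝕜) where
  lt_top E _ _ _ x hx := (mem_carrier_RAD_iff 𝕜).1 hx
  norm_eq E _ _ _ x _ := norm_RAD_eq 𝕜 x
  add_mem E _ _ _ x hx y hy := by
    rw [mem_carrier_RAD_iff] at hx hy ⊢
    exact (extRadNorm_add_le 𝕜 x y).trans_lt (ENNReal.add_lt_top.2 ⟨hx, hy⟩)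
  smul_mem E _ _ _ c x hx := by
    rw [mem_carrier_RAD_iff] at hx ⊢
    rw [extRadNorm_smul]
    exact ENNReal.mul_lt_top enorm_lt_top hx
  finite_mem E _ _ _ x hx := (mem_carrier_RAD_iff 𝕜).2
    ((mem_carrier_Rad_iff 𝕜).1 (mem_carrier_Rad_of_finite 𝕜 hx)).extRadNorm_lt_top
  closed E _ _ _ x hx := by
    obtain ⟨y, hy, hyx⟩ := hx 1 one_ne_zero
    rw [mem_carrier_RAD_iff] at hy ⊢
    have hsplit : x = y + (-1 : 𝕜) • (y - x) := by rw [neg_one_smul]; abel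
    rw [hsplit]
    refine (extRadNorm_add_le 𝕜 _ _).trans_lt (ENNReal.add_lt_top.2 ⟨hy, ?_⟩)
    rw [extRadNorm_smul]
    exact ENNReal.mul_lt_top enorm_lt_top (hyx.trans_lt ENNReal.one_lt_top)
  induced_mem n hn E F _ _ _ _ _ _ A x hx := by
    rw [mem_carrier_RAD_iff]
    refine (extRadNorm_inducedSeq_le hn A x).trans_lt (ENNReal.mul_lt_top enorm_lt_top ?_)
    exact ENNReal.prod_lt_top fun m _ => (mem_carrier_RAD_iff 𝕜).1 (hx m)

theorem theorem3p5 (𝕜 : Type) [RCLike 𝕜] :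
    MultilinearlyStable (Rad.{u} 𝕜) ∧ MultilinearlyStable (RAD.{u} 𝕜) :=
  ⟨(isRademacherRule_Rad 𝕜).multilinearlyStable, (isRademacherRule_RAD 𝕜).multilinearlyStable⟩
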